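/- **Theorem ($h$-Swapping).** Let $n\ge 1$, $p\ge 0$, and consider the strict-feedback plant $\dot x_i=x_{i+1}+\varphi_i(x_1,\dots,x_i)^{\mathsf T}\theta$ ($1\le i\le n-1$), $\dot x_n=u+\varphi_n(x)^{\mathsf T}\theta$, $y=x_1$, with smooth $\varphi_i$ with values in $\mathbb R^p$ and an unknown constant $\theta\in\mathbb R^p$. Let $r:[0,\infty)\to\mathbb R$ be such that $r,\dot r,\dots,r^{(n)}$ are bounded and $r^{(n)}$ (defined up to a locally finite set of break points) is piecewise continuous, with $r^{(n-1)}$ continuous. Let $c_i,\kappa_i,g_i>0$ ($1\le i\le n$), $\Gamma=\Gamma^{\mathsf T}>0$ and $\nu\ge0$. With an estimate $\hat\theta$ of $\theta$ and $\tilde\theta=\theta-\hat\theta$, put $\alpha_0=0$ and, for $i=1,\dots,n$, $$h_i=x_i-\alpha_{i-1}-r^{(i-1)},\qquad w_i=\varphi_i-\sum_{j=1}^{i-1}\frac{\partial\alpha_{i-1}}{\partial x_j}\varphi_j,\qquad s_i=c_i+\kappa_i|w_i|^2+g_i\Big|\frac{\partial\alpha_{i-1}}{\partial\hat\theta}\Big|^2,$$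 $$\alpha_i=-s_ih_i-w_i^{\mathsf T}\hat\theta+\sum_{k=1}^{i-1}\Big(\frac{\partial\alpha_{i-1}}{\partial x_k}x_{k+1}+\frac{\partial\alpha_{i-1}}{\partial r^{(k-1)}}r^{(k)}\Big),\qquad \bar u=\alpha_n+r^{(n)}.$$ Let $h=(h_1,\dots,h_n)^{\mathsf T}$, let $A$ be the $n\times n$ matrix with diagonal entries $-s_1,\dots,-s_n$, superdiagonal entries $1$ and all other entries $0$, and let $W=[w_1,\dots,w_n]$, $Q=\big[0,-(\partial\alpha_1/\partial\hat\theta)^{\mathsf T},\dots,-(\partial\alpha_{n-1}/\partial\hat\theta)^{\mathsf T}\big]$. Consider the closed loop consisting of the plant with $u=\bar u$ and $$\dot\Omega^{\mathsf T}=A\Omega^{\mathsf T}+W^{\mathsf T},\qquad \dot\Omega_0=A\Omega_0+W^{\mathsf T}\hat\theta-Q^{\mathsf T}\dot{\hat\theta},\qquad \epsilon=h+\Omega_0-\Omega^{\mathsf T}\hat\theta,\qquad \dot{\hat\theta}=\Gamma\frac{\Omega\epsilon}{1+\nu|\Omega|_F^2},$$ where $\Omega\in\mathbb R^{p\times n}$,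 $\Omega_0\in\mathbb R^n$, and solutions are continuous functions satisfying the differential equations up to a locally finite set of times. Then: (i) For every initial time $t_0\ge0$ and every initial state $(x,\hat\theta,\Omega,\Omega_0)(t_0)$ there is a solution on $[t_0,\infty)$. All closed-loop signals are globally uniformly bounded: for every $R$ there is a $B$ such that, for every $t_0\ge0$ and every solution on $[t_0,T)$, $T\le\infty$, whose initial state is bounded by $R$, the signals $x,\hat\theta,\tilde\theta,\Omega,\Omega_0,h,\epsilon,u,\dot{\hat\theta}$ are bounded by $B$ on $[t_0,T)$. Moreover, asymptotic tracking is achieved: $h_1(t)=y(t)-r(t)\to0$ as $t\to\infty$ for every solution on $[t_0,\infty)$. (ii) Let $\nu>0$ and $\Gamma=\gamma I$ with $\gamma>0$. For $1\le i\le n-1$ let $$\underline c_i=-\frac{N_i}{h_i(0)},\qquad N_i=x_{i+1}(0)-r^{(i)}(0)+w_i(0)^{\mathsf T}\hat\theta(0)-\sum_{j=1}^{i-1}\Big(\frac{\partial\alpha_{i-1}(0)}{\partial x_j}x_{j+1}(0)+\frac{\partial\alpha_{i-1}(0)}{\partial r^{(j-1)}}r^{(j)}(0)\Big),$$ and suppose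 that $c_i\ge\max\{\underline c_i,0\}$ for $1\le i\le n-1$ (where, if $h_i(0)=0$, this condition is read as $N_i\ge0$). If $h_1(0)\ge0$, $\Omega(0)=0$ and $\Omega_0(0)=-h(0)$, then, for all $t\ge 0$ in the interval of definition of the solution, $$-h_1^*\le h_1(t)\le e^{-\underline c t}\sum_{i=1}^n\frac{t^{i-1}}{(i-1)!}h_i(0)+h_1^*,\qquad h_1^*=\frac{\underline c^{\,n}-1}{2\underline c^{\,n-1}(\underline c-1)}\Big(\frac1{\sqrt{\underline c\,\underline\kappa}}+\frac{\gamma}{\nu\sqrt{\underline c\,\underline g}}\Big)|\tilde\theta(0)|,$$ where $\underline c=\min_{i}c_i$, $\underline\kappa=\min_i\kappa_i$, $\underline g=\min_{i\ge2}g_i$; for $\underline c=1$ the quotient $\frac{\underline c^{\,n}-1}{\underline c^{\,n-1}(\underline c-1)}$ is read as its limit $n$, and for $n=1$ the term with $\underline g$ is absent. -/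

import Mathlib

open scoped ContDiff Topology Matrix
open Filter

noncomputable section

namespace HSwap

/-- Column vectors. The index `i : Fin m` is `0`-based, so the entry `v i` is the mathematical
`v_{i+1}`. -/
abbrev Vec (m : ℕ) : Type := Fin m → ℝ

/-- The Euclidean norm of a vector. -/
def vnorm {m : ℕ} (v : Vec m) : ℝ := ‖WithLp.toLp 2 v‖

/-- The squared Frobenius norm of a matrix. -/
def frobSq {p n : ℕ} (M : Matrix (Fin p) (Fin n) ℝ) : ℝ := ∑ j, ∑ i, M j i ^ 2

/-! ### Piecewise regularity in time -/

/-- `D` has only finitely many points in every compact initial part of `J`. -/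
def LocFiniteIn (D J : Set ℝ) : Prop := ∀ b ∈ J, (D ∩ J ∩ Set.Iic b).Finite

/-- `f` is continuous on `J` up to a locally finite set of break points. -/
def PiecewiseContOn (f : ℝ → ℝ) (J : Set ℝ) : Prop :=
  ∃ D : Set ℝ, LocFiniteIn D J ∧ ∀ t ∈ J \ D, ContinuousWithinAt f J t

/-- `f` is continuous on `J` and has derivative `f'` up to a locally finite set of break points. -/
def HasPiecewiseDerivOn (f f' : ℝ → ℝ) (J : Set ℝ) : Prop :=
  ContinuousOn f J ∧
    ∃ D : Set ℝ, LocFiniteIn D J ∧ ∀ t ∈ J \ D, HasDerivWithinAt f (f' t) J t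

/-- `r 0` is a reference signal on `[0,∞)` and `r k` is its `k`-th derivative, `k ≤ n`; these are
bounded, and the `n`-th derivative (defined up to break points) is piecewise continuous. -/
structure IsReference (n : ℕ) (r : ℕ → ℝ → ℝ) : Prop where
  deriv_lt : ∀ k, k + 1 < n → ∀ t, 0 ≤ t → HasDerivWithinAt (r k) (r (k + 1) t) (Set.Ici 0) t
  deriv_last : ∀ k, k + 1 = n → HasPiecewiseDerivOn (r k) (r n) (Set.Ici 0)
  piecewise_cont : PiecewiseContOn (r n) (Set.Ici 0)
  bounded : ∀ k, k ≤ n → ∃ M, ∀ t, 0 ≤ t → |r k t| ≤ M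

/-! ### The backstepping controller -/

/-- Points `(x, (r, r', …, r^{(n-1)}), θ̂)`, the arguments of the virtual controls. -/
abbrev Pt (n p : ℕ) : Type := Vec n × Vec n × Vec p

variable {n p : ℕ}

/-- `∂f/∂x_k`. -/
def dX (f : Pt n p → ℝ) (q : Pt n p) (k : Fin n) : ℝ := fderiv ℝ f q (Pi.single k 1, 0, 0)

/-- `∂f/∂r^{(k)}`. -/
def dR (f : Pt n p → ℝ) (q : Pt n p) (k : Fin n) : ℝ := fderiv ℝ f q (0, Pi.single k 1, 0)

/-- `∂f/∂θ̂`, as a vector. -/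
def dTheta (f : Pt n p → ℝ) (q : Pt n p) : Vec p := fun j => fderiv ℝ f q (0, 0, Pi.single j 1)

/-- The entry of `v` after the `i`-th one; `last` stands for the entry after the final one. -/
def succCoord (v : Vec n) (last : ℝ) (i : Fin n) : ℝ :=
  if hi : i.val + 1 < n then v ⟨i.val + 1, hi⟩ else last

/-- The regressors `φ_i` depend on `x_1, …, x_i` only. -/
def IsStrictFeedback (φ : Fin n → Vec n → Vec p) : Prop :=
  ∀ i x y, (∀ j ≤ i, x j = y j) → φ i x = φ i y

/-- The gains `c_i, κ_i, g_i` of the controller, the adaptation gain matrix `Γ` and the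
normalization gain `ν`. -/
structure Design (n p : ℕ) where
  c : Fin n → ℝ
  κ : Fin n → ℝ
  g : Fin n → ℝ
  Γ : Matrix (Fin p) (Fin p) ℝ
  ν : ℝ

/-- Admissible gains: `c_i, κ_i, g_i > 0`, `Γ = Γᵀ > 0` and `ν ≥ 0`. -/
structure Design.Admissible (d : Design n p) : Prop where
  c_pos : ∀ i, 0 < d.c i
  κ_pos : ∀ i, 0 < d.κ i
  g_pos : ∀ i, 0 < d.g i
  Γ_pos : d.Γ.PosDef
  ν_nonneg : 0 ≤ d.ν

/-- `w_i = φ_i - ∑_{k<i} (∂a/∂x_k) φ_k`, where `a` is the preceding virtual control. -/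
def wOf (φ : Fin n → Vec n → Vec p) (a : Pt n p → ℝ) (i : Fin n) (q : Pt n p) : Vec p :=
  φ i q.1 - ∑ k ∈ Finset.Iio i, dX a q k • φ k q.1

/-- `s_i = c_i + κ_i |w_i|² + g_i |∂a/∂θ̂|²`, where `a` is the preceding virtual control. -/
def sOf (d : Design n p) (φ : Fin n → Vec n → Vec p) (a : Pt n p → ℝ) (i : Fin n)
    (q : Pt n p) : ℝ :=
  d.c i + d.κ i * vnorm (wOf φ a i q) ^ 2 + d.g i * vnorm (dTheta a q) ^ 2

/-- `∑_{k<i} ((∂a/∂x_k) x_{k+1} + (∂a/∂r^{(k-1)}) r^{(k)})` (mathematical, `1`-based indices), where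
`a` is the preceding virtual control. In this range of `k` the next entries exist. -/
def driftOf (a : Pt n p → ℝ) (i : Fin n) (q : Pt n p) : ℝ :=
  ∑ k ∈ Finset.Iio i, (dX a q k * succCoord q.1 0 k + dR a q k * succCoord q.2.1 0 k)

/-- The virtual controls: `alpha j` is `α_j` for `0 ≤ j ≤ n` (and zero for `j > n`). With `0`-based
`i : Fin n`, `alpha i` precedes and `alpha (i+1)` belongs to the error coordinate
`h_i = x_i - alpha i - r^{(i)}`. -/
def alpha (d : Design n p) (φ : Fin n → Vec n → Vec p) : ℕ → Pt n p → ℝ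
  | 0 => fun _ => 0
  | j + 1 =>
    if hj : j < n then fun q =>
      -(sOf d φ (alpha d φ j) ⟨j, hj⟩ q * (q.1 ⟨j, hj⟩ - alpha d φ j q - q.2.1 ⟨j, hj⟩))
        - wOf φ (alpha d φ j) ⟨j, hj⟩ q ⬝ᵥ q.2.2
        + driftOf (alpha d φ j) ⟨j, hj⟩ q
    else fun _ => 0

/-- `h_i = x_i - α_{i-1} - r^{(i-1)}`. -/
def hErr (d : Design n p) (φ : Fin n → Vec n → Vec p) (q : Pt n p) : Vec n :=
  fun i => q.1 i - alpha d φ i.val q - q.2.1 i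

/-- `w_i`. -/
def w (d : Design n p) (φ : Fin n → Vec n → Vec p) (q : Pt n p) (i : Fin n) : Vec p :=
  wOf φ (alpha d φ i.val) i q

/-- `s_i`. -/
def s (d : Design n p) (φ : Fin n → Vec n → Vec p) (q : Pt n p) (i : Fin n) : ℝ :=
  sOf d φ (alpha d φ i.val) i q

/-- The bidiagonal matrix `A` with diagonal `-s_i` and superdiagonal `1`. -/
def A (d : Design n p) (φ : Fin n → Vec n → Vec p) (q : Pt n p) : Matrix (Fin n) (Fin n) ℝ :=
  Matrix.of fun i k => if k = i then -s d φ q i else if k.val = i.val + 1 then 1 else 0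

/-- The matrix `W = [w_1, …, w_n]`. -/
def W (d : Design n p) (φ : Fin n → Vec n → Vec p) (q : Pt n p) : Matrix (Fin p) (Fin n) ℝ :=
  Matrix.of fun j i => w d φ q i j

/-- The matrix `Q` with columns `-(∂α_{i-1}/∂θ̂)ᵀ`; the first one is zero because `α_0 = 0`. -/
def Q (d : Design n p) (φ : Fin n → Vec n → Vec p) (q : Pt n p) : Matrix (Fin p) (Fin n) ℝ :=
  Matrix.of fun j i => -dTheta (alpha d φ i.val) q j

/-! ### The closed loop -/

/-- States of the closed loop: plant state, parameter estimate and the two filters. -/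
structure State (n p : ℕ) where
  x : Vec n
  θhat : Vec p
  Ω : Matrix (Fin p) (Fin n) ℝ
  Ω₀ : Vec n

/-- The point at which the virtual controls are evaluated in state `z` at time `t`. -/
def pt (r : ℕ → ℝ → ℝ) (t : ℝ) (z : State n p) : Pt n p := (z.x, fun i => r i.val t, z.θhat)

/-- The error coordinates `h` in state `z` at time `t`. -/
def hAt (d : Design n p) (φ : Fin n → Vec n → Vec p) (r : ℕ → ℝ → ℝ) (t : ℝ) (z : State n p) :
    Vec n := hErr d φ (pt r t z)

/-- The control `ū = α_n + r^{(n)}`. -/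
def control (d : Design n p) (φ : Fin n → Vec n → Vec p) (r : ℕ → ℝ → ℝ) (t : ℝ)
    (z : State n p) : ℝ := alpha d φ n (pt r t z) + r n t

/-- `ε = h + Ω₀ - Ωᵀ θ̂`. -/
def eps (d : Design n p) (φ : Fin n → Vec n → Vec p) (r : ℕ → ℝ → ℝ) (t : ℝ) (z : State n p) :
    Vec n := hAt d φ r t z + z.Ω₀ - z.Ωᵀ *ᵥ z.θhat

/-- The update law `Γ Ω ε / (1 + ν |Ω|_F²)`. -/
def updateLaw (d : Design n p) (φ : Fin n → Vec n → Vec p) (r : ℕ → ℝ → ℝ) (t : ℝ)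
    (z : State n p) : Vec p :=
  (1 + d.ν * frobSq z.Ω)⁻¹ • (d.Γ *ᵥ (z.Ω *ᵥ eps d φ r t z))

/-- `z` solves the closed loop (plant with parameter `θ`, controller, filters and update law) on the
time interval `J`: all components are continuous, and the differential equations hold up to a
locally finite set of times. -/
structure IsSolution (d : Design n p) (φ : Fin n → Vec n → Vec p) (θ : Vec p) (r : ℕ → ℝ → ℝ)
    (J : Set ℝ) (z : ℝ → State n p) : Prop where
  plant : ∀ i, HasPiecewiseDerivOn (fun t => (z t).x i)
    (fun t => succCoord (z t).x (control d φ r t (z t)) i + φ i (z t).x ⬝ᵥ θ) J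
  filter : ∀ i j, HasPiecewiseDerivOn (fun t => (z t).Ωᵀ i j)
    (fun t => (A d φ (pt r t (z t)) * (z t).Ωᵀ + (W d φ (pt r t (z t)))ᵀ) i j) J
  filter₀ : ∀ i, HasPiecewiseDerivOn (fun t => (z t).Ω₀ i)
    (fun t => (A d φ (pt r t (z t)) *ᵥ (z t).Ω₀ + (W d φ (pt r t (z t)))ᵀ *ᵥ (z t).θhat
      - (Q d φ (pt r t (z t)))ᵀ *ᵥ updateLaw d φ r t (z t)) i) J
  update : ∀ j, HasPiecewiseDerivOn (fun t => (z t).θhat j)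
    (fun t => updateLaw d φ r t (z t) j) J

/-- The time intervals `[t₀, ∞)` and `[t₀, T)`. -/
def IsHorizon (t₀ : ℝ) (J : Set ℝ) : Prop := J = Set.Ici t₀ ∨ ∃ T, J = Set.Ico t₀ T

/-- The closed-loop state is bounded by `R`. -/
def State.BoundedBy (z : State n p) (R : ℝ) : Prop :=
  vnorm z.x ≤ R ∧ vnorm z.θhat ≤ R ∧ √(frobSq z.Ω) ≤ R ∧ vnorm z.Ω₀ ≤ R

/-- All signals of the closed loop in state `z` at time `t` are bounded by `B`: the state,
the error coordinates, the parameter error, `ε`, the control and the derivative of `θ̂`. -/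
def SignalsBoundedBy (d : Design n p) (φ : Fin n → Vec n → Vec p) (θ : Vec p) (r : ℕ → ℝ → ℝ)
    (t : ℝ) (z : State n p) (B : ℝ) : Prop :=
  z.BoundedBy B ∧ vnorm (hAt d φ r t z) ≤ B ∧ vnorm (θ - z.θhat) ≤ B ∧
    vnorm (eps d φ r t z) ≤ B ∧ |control d φ r t z| ≤ B ∧ vnorm (updateLaw d φ r t z) ≤ B

/-! ### The choice of gains and the violation bound -/

/-- `x_{i+1} - r^{(i)} + w_iᵀ θ̂ - ∑_{k<i} ((∂α_{i-1}/∂x_k) x_{k+1} + (∂α_{i-1}/∂r^{(k-1)}) r^{(k)})`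
(mathematical, `1`-based indices), for `i < n`. -/
def gainNumerator (d : Design n p) (φ : Fin n → Vec n → Vec p) (q : Pt n p) (i : Fin n) : ℝ :=
  succCoord q.1 0 i - succCoord q.2.1 0 i + w d φ q i ⬝ᵥ q.2.2 - driftOf (alpha d φ i.val) i q

/-- The lower bound `c̲_i` on the gain `c_i`, meaningful where `h_i ≠ 0`. -/
def gainLower (d : Design n p) (φ : Fin n → Vec n → Vec p) (q : Pt n p) (i : Fin n) : ℝ :=
  -((hErr d φ q i)⁻¹ * gainNumerator d φ q i)

/-- The choice of gains `c_i ≥ max {c̲_i, 0}` for `i = 1, …, n-1`, at the initial point `q`. If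
`h_i = 0`, then `c̲_i` is read as an infinite quantity: no choice of `c_i` is possible when the
numerator is negative (`c̲_i = +∞`), and there is no restriction otherwise. -/
def GainChoice (d : Design n p) (φ : Fin n → Vec n → Vec p) (q : Pt n p) : Prop :=
  ∀ i : Fin n, i.val + 1 < n →
    (hErr d φ q i ≠ 0 → max (gainLower d φ q i) 0 ≤ d.c i) ∧
    (hErr d φ q i = 0 → 0 ≤ gainNumerator d φ q i)

/-- `c̲ = min_i c_i`. -/
def Design.cMin (d : Design n p) : ℝ := ⨅ i, d.c i

/-- `κ̲ = min_i κ_i`. -/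
def Design.κMin (d : Design n p) : ℝ := ⨅ i, d.κ i

/-- `g̲ = min_{i ≥ 2} g_i` (used for `n ≥ 2` only). -/
def Design.gMin (d : Design n p) : ℝ := ⨅ i : {i : Fin n // 0 < i.val}, d.g i.val

/-- `(c^n - 1) / (c^{n-1} (c - 1))`, with its continuous extension `n` at `c = 1`. -/
def geomFactor (n : ℕ) (c : ℝ) : ℝ :=
  if c = 1 then (n : ℝ) else (c ^ n - 1) / (c ^ (n - 1) * (c - 1))

/-- The violation bound `h_1^*` for `Γ = γ I`, as a function of `e = |θ̃(0)|`. For `n = 1` there is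
no gain `g_i` with `i ≥ 2`, and the second term is absent. -/
def hStar (d : Design n p) (γ e : ℝ) : ℝ :=
  geomFactor n d.cMin / 2 *
    (1 / √(d.cMin * d.κMin) + (if n = 1 then 0 else γ / (d.ν * √(d.cMin * d.gMin)))) * e

end HSwap

end

noncomputable section

namespace HSwap

/-! ### Scalar comparison arguments: cascades of inequalities and convergence from dissipation -/

section

/-! ### Differential inequalities off a finite set -/

/-! The filters reduce adaptation to a static linear error model. The virtual controls give h' = A h
+ Wᵀθ̃ + Qᵀθ̂', and the filters are built so that ε̃ = h + Ω₀ - Ωᵀθ satisfies ε̃' = A ε̃, while ε =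
ε̃ + Ωᵀθ̃. What remains concerns the bidiagonal cascade A.

The gains s_i are bounded below but have no a priori upper bound. By the AM-GM inequality
(`le_div_two_sqrt`) they dominate |w_i| and |∂α_{i-1}/∂θ̂|, so every disturbance with bounded θ̃ and
θ̂' is at most s_i M. For such disturbances `cascade_le` bounds the cascade by its nominal free
response plus M ∑ c^{-k}, however large the s_i are.

Boundedness therefore does not presuppose a bound on x. First ε̃ decays exponentially; then θ̃ᵀΓ⁻¹θ̃
plus a decaying exponential is nonincreasing (`SolvesAt.exists_dissipation`), which bounds θ̃; the
cascade bounds Ω, hence ε and θ̂', hence h; and x is recovered coordinate by coordinate, because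
α_{i-1} depends on x_1, …, x_{i-1} only (`alpha_cut`). These bounds also hold on finite horizons, so
they exclude blow-up and yield global existence.

For tracking, the dissipated quantity |ε|² has a bounded derivative and so tends to zero
(`tendsto_zero_of_dissipation`); then θ̂' → 0. The remainder χ = Ω₀ - Ωᵀθ̂ is a cascade driven by
θ̂' alone, so χ → 0 and h = ε - χ → 0.

For the violation bounds, the choice of gains makes h(0) ≥ 0 and the filter initialization makes ε̃
vanish identically. Then |θ̃| does not grow, normalization gives |θ̂'| ≤ (γ/ν)|θ̃(0)|, and
`cascade_le` applies with explicit constants. -/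

theorem le_of_deriv_nonpos_off_finite {f : ℝ → ℝ} {D : Set ℝ} (hD : D.Finite) :
    ∀ {a b : ℝ}, a ≤ b → ContinuousOn f (Set.Icc a b) →
      (∀ t ∈ Set.Ioo a b \ D, ∃ f' ≤ 0, HasDerivAt f f' t) → f b ≤ f a := by
  induction D, hD using Set.Finite.induction_on with
  | empty =>
    intro a b hab hc hd
    have hd' : ∀ t ∈ interior (Set.Icc a b), ∃ f' ≤ 0, HasDerivAt f f' t := by
      intro t ht
      rw [interior_Icc] at ht
      exact hd t ⟨ht, Set.notMem_empty t⟩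
    refine antitoneOn_of_deriv_nonpos (convex_Icc a b) hc ?_ ?_ (Set.left_mem_Icc.2 hab)
      (Set.right_mem_Icc.2 hab) hab
    · intro t ht
      obtain ⟨f', -, h⟩ := hd' t ht
      exact h.differentiableAt.differentiableWithinAt
    · intro t ht
      obtain ⟨f', h0, h⟩ := hd' t ht
      rwa [h.deriv]
  | @insert c D _ _ ih =>
    intro a b hab hc hd
    by_cases hcab : c ∈ Set.Ioo a b
    -- Split at the exceptional point; inside each half it no longer occurs.
    · refine (ih hcab.2.le (hc.mono (Set.Icc_subset_Icc_left hcab.1.le)) ?_).trans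
        (ih hcab.1.le (hc.mono (Set.Icc_subset_Icc_right hcab.2.le)) ?_)
      · rintro t ⟨ht, htD⟩
        refine hd t ⟨⟨hcab.1.trans ht.1, ht.2⟩, ?_⟩
        rintro (rfl | h)
        exacts [lt_irrefl _ ht.1, htD h]
      · rintro t ⟨ht, htD⟩
        refine hd t ⟨⟨ht.1, ht.2.trans hcab.2⟩, ?_⟩
        rintro (rfl | h)
        exacts [lt_irrefl _ ht.2, htD h]
    · refine ih hab hc ?_
      rintro t ⟨ht, htD⟩
      refine hd t ⟨ht, ?_⟩
      rintro (rfl | h)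
      exacts [hcab ht, htD h]

/-- If `f` starts nonpositive and cannot increase while it is positive, it stays nonpositive. -/
theorem nonpos_of_deriv_nonpos_of_pos {f : ℝ → ℝ} {D : Set ℝ} (hD : D.Finite) {a b : ℝ}
    (hc : ContinuousOn f (Set.Icc a b))
    (hd : ∀ t ∈ Set.Ioo a b \ D, 0 < f t → ∃ f' ≤ 0, HasDerivAt f f' t) (ha : f a ≤ 0) :
    ∀ t ∈ Set.Icc a b, f t ≤ 0 := by
  intro t ht
  by_contra! hpos
  set S := Set.Icc a t ∩ f ⁻¹' Set.Iic 0 with hS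
  have hct : ContinuousOn f (Set.Icc a t) := hc.mono (Set.Icc_subset_Icc_right ht.2)
  have hScl : IsClosed S := hct.preimage_isClosed_of_isClosed isClosed_Icc isClosed_Iic
  have hSc : IsCompact S := isCompact_Icc.of_isClosed_subset hScl Set.inter_subset_left
  -- Last time before `t` at which `f ≤ 0`: after it `f` is positive, hence cannot increase.
  obtain ⟨σ, hσ, hmax⟩ := hSc.exists_isGreatest ⟨a, Set.left_mem_Icc.2 ht.1, ha⟩
  have h := le_of_deriv_nonpos_off_finite hD hσ.1.2
    (hct.mono (Set.Icc_subset_Icc_left hσ.1.1)) (f := f) ?_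
  · exact absurd (h.trans hσ.2) (not_le.2 hpos)
  · rintro u ⟨hu, huD⟩
    refine hd u ⟨⟨hσ.1.1.trans_lt hu.1, hu.2.trans_le ht.2⟩, huD⟩ ?_
    by_contra! hle
    exact absurd (hmax ⟨⟨hσ.1.1.trans hu.1.le, hu.2.le⟩, hle⟩) (not_le.2 hu.1)

/-! ### Cascades of scalar differential inequalities -/

/-- `e^{-ct} ∑_{k<N} t^k/k! a_{i+k}`, the response of the nominal cascade to its initial state. -/
def freeResponse (c : ℝ) (a : ℕ → ℝ) (N i : ℕ) (t : ℝ) : ℝ :=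
  Real.exp (-c * t) * ∑ k ∈ Finset.range N, t ^ k / (k.factorial : ℝ) * a (i + k)

theorem freeResponse_nonneg {c : ℝ} {a : ℕ → ℝ} (ha : ∀ i, 0 ≤ a i) (N i : ℕ) {t : ℝ}
    (ht : 0 ≤ t) : 0 ≤ freeResponse c a N i t :=
  mul_nonneg (Real.exp_pos _).le (Finset.sum_nonneg fun k _ => mul_nonneg (by positivity) (ha _))

/-- The free response solves the nominal cascade with all gains equal to `c`: differentiating the
polynomial lowers each power and shifts the initial data by one. -/
theorem hasDerivAt_freeResponse_succ (c : ℝ) (a : ℕ → ℝ) (N i : ℕ) (t : ℝ) :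
    HasDerivAt (freeResponse c a (N + 1) i)
      (-c * freeResponse c a (N + 1) i t + freeResponse c a N (i + 1) t) t := by
  have h1 : HasDerivAt (fun t => Real.exp (-c * t)) (Real.exp (-c * t) * -c) t := by
    simpa using ((hasDerivAt_id t).const_mul (-c)).exp
  have h2 : HasDerivAt
      (fun t : ℝ => ∑ k ∈ Finset.range (N + 1), t ^ k / (k.factorial : ℝ) * a (i + k))
      (∑ k ∈ Finset.range N, t ^ k / (k.factorial : ℝ) * a (i + 1 + k)) t := by
    have h3 : HasDerivAt
        (fun t : ℝ => ∑ k ∈ Finset.range (N + 1), t ^ k / (k.factorial : ℝ) * a (i + k))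
        (∑ k ∈ Finset.range (N + 1), ((k : ℝ) * t ^ (k - 1)) / (k.factorial : ℝ) * a (i + k)) t :=
      HasDerivAt.fun_sum fun k _ => ((hasDerivAt_pow k t).div_const _).mul_const _
    convert h3 using 1
    rw [Finset.sum_range_succ']
    simp only [Nat.cast_zero, zero_mul, zero_div, add_zero]
    refine Finset.sum_congr rfl fun k _ => ?_
    have hk : ((k + 1 : ℕ) : ℝ) ≠ 0 := by positivity
    rw [Nat.factorial_succ, Nat.cast_mul, Nat.add_sub_cancel, mul_div_mul_left _ _ hk]
    congr 2
    omega
  refine (h1.mul h2).congr_deriv ?_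
  simp only [freeResponse]
  ring

/-- `∑_{k<N} c^{-k}`, the amplification of a disturbance along a cascade. -/
def cascadeGain (c : ℝ) (N : ℕ) : ℝ := ∑ k ∈ Finset.range N, c⁻¹ ^ k

theorem cascadeGain_nonneg {c : ℝ} (hc : 0 < c) (N : ℕ) : 0 ≤ cascadeGain c N :=
  Finset.sum_nonneg fun k _ => by positivity

theorem cascadeGain_succ (c : ℝ) (N : ℕ) : cascadeGain c (N + 1) = 1 + c⁻¹ * cascadeGain c N := by
  rw [cascadeGain, Finset.sum_range_succ', cascadeGain, Finset.mul_sum, add_comm]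
  simp [pow_succ']

theorem cascadeGain_mono {c : ℝ} (hc : 0 < c) {N N' : ℕ} (h : N ≤ N') :
    cascadeGain c N ≤ cascadeGain c N' :=
  Finset.sum_le_sum_of_subset_of_nonneg (Finset.range_mono h) fun k _ _ => by positivity

/-- Climb from the last equation upwards. With U_i the free response and G_N the cascade gain, the
derivative of ξ_i - U_i - M G_{N+1} is at most -s(ξ_i - U_i - M G_{N+1}) + (c - s)U_i + M G_N (1 -
s/c). Since s ≥ c and U_i ≥ 0, the last two terms are nonpositive, so the difference cannot increase
while positive. No upper bound on s enters, because the disturbance is measured in units of s. -/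
theorem cascade_le {n : ℕ} {c M : ℝ} (hc : 0 < c) (hM : 0 ≤ M) {t₀ b : ℝ} {D : Set ℝ}
    (hD : D.Finite) {ξ s : ℕ → ℝ → ℝ} {a : ℕ → ℝ} (ha : ∀ i, 0 ≤ a i)
    (hcont : ∀ i < n, ContinuousOn (ξ i) (Set.Icc t₀ b)) (hn : ∀ t, ξ n t ≤ 0)
    (h0 : ∀ i < n, ξ i t₀ ≤ a i)
    (hd : ∀ t ∈ Set.Ioo t₀ b \ D, ∀ i < n, c ≤ s i t ∧ ∃ ξ', HasDerivAt (ξ i) ξ' t ∧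
      ξ' ≤ -s i t * ξ i t + ξ (i + 1) t + s i t * M) :
    ∀ N i, i + N = n → ∀ t ∈ Set.Icc t₀ b,
      ξ i t ≤ freeResponse c a N i (t - t₀) + M * cascadeGain c N := by
  intro N
  induction N with
  | zero =>
    rintro i hi t -
    obtain rfl : i = n := by omega
    simpa [freeResponse, cascadeGain] using hn t
  | succ N ih =>
    intro i hi
    have hin : i < n := by omega
    have ih' := ih (i + 1) (by omega)
    have hder : ∀ t, HasDerivAt (fun t => freeResponse c a (N + 1) i (t - t₀))
        (-c * freeResponse c a (N + 1) i (t - t₀) + freeResponse c a N (i + 1) (t - t₀)) t :=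
      fun t => (hasDerivAt_freeResponse_succ c a N i (t - t₀)).comp_sub_const t t₀
    have key : ∀ t ∈ Set.Icc t₀ b,
        ξ i t - freeResponse c a (N + 1) i (t - t₀) - M * cascadeGain c (N + 1) ≤ 0 := by
      refine nonpos_of_deriv_nonpos_of_pos hD ?_ ?_ ?_
      · exact ((hcont i hin).sub fun t _ => (hder t).continuousAt.continuousWithinAt).sub
          continuousOn_const
      · intro t ht hpos
        obtain ⟨hs, ξ', hξ, hle⟩ := hd t ht i hin
        refine ⟨_, ?_, (hξ.sub (hder t)).sub_const _⟩
        have hU := freeResponse_nonneg (c := c) ha (N + 1) i (t := t - t₀) (by linarith [ht.1.1])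
        have h1 := ih' t ⟨ht.1.1.le, ht.1.2.le⟩
        have hG := cascadeGain_nonneg hc N
        rw [cascadeGain_succ] at hpos
        -- The disturbance inherited from the next equation is not scaled by `s`; the factor 1/c in
        -- the gain recursion pays for this.
        have h2 : M * cascadeGain c N ≤ s i t * (M * (c⁻¹ * cascadeGain c N)) := by
          have : c * (M * (c⁻¹ * cascadeGain c N)) = M * cascadeGain c N := by field_simp
          rw [← this]
          gcongr
        set U := freeResponse c a (N + 1) i (t - t₀)
        have h3 : 0 ≤ s i t * (ξ i t - U - M * (1 + c⁻¹ * cascadeGain c N)) :=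
          mul_nonneg (hc.le.trans hs) hpos.le
        have h4 : c * U ≤ s i t * U := by gcongr
        nlinarith
      · have hg := mul_nonneg hM (cascadeGain_nonneg hc (N + 1))
        have : freeResponse c a (N + 1) i (t₀ - t₀) = a i := by
          simp [freeResponse, Finset.sum_range_succ']
        rw [this]
        linarith [h0 i hin]
    intro t ht
    linarith [key t ht]

/-- Half of the decay rate is spent on absorbing the polynomial factor of the free response; the
other half remains. -/
theorem pow_div_factorial_le {c t : ℝ} (hc : 0 < c) (ht : 0 ≤ t) (k : ℕ) :
    t ^ k / (k.factorial : ℝ) ≤ (2 / c) ^ k * Real.exp (c / 2 * t) := by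
  have h := Real.pow_div_factorial_le_exp (c / 2 * t) (by positivity) k
  calc t ^ k / (k.factorial : ℝ) = (2 / c) ^ k * ((c / 2 * t) ^ k / (k.factorial : ℝ)) := by
        rw [mul_pow, mul_div_assoc, ← mul_assoc, ← mul_pow]
        field_simp
        simp
    _ ≤ _ := by gcongr

theorem freeResponse_le {c R : ℝ} (hc : 0 < c) {a : ℕ → ℝ} (ha : ∀ i, 0 ≤ a i)
    (haR : ∀ i, a i ≤ R) {N n : ℕ} (hN : N ≤ n) (i : ℕ) {t : ℝ} (ht : 0 ≤ t) :
    freeResponse c a N i t ≤ (∑ k ∈ Finset.range n, (2 / c) ^ k) * R * Real.exp (-(c / 2) * t) := by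
  have hR : 0 ≤ R := (ha 0).trans (haR 0)
  have h1 : ∑ k ∈ Finset.range N, t ^ k / (k.factorial : ℝ) * a (i + k) ≤
      ∑ k ∈ Finset.range n, (2 / c) ^ k * Real.exp (c / 2 * t) * R := by
    refine (Finset.sum_le_sum_of_subset_of_nonneg (Finset.range_mono hN) fun k _ _ =>
      mul_nonneg (by positivity) (ha _)).trans (Finset.sum_le_sum fun k _ => ?_)
    exact mul_le_mul (pow_div_factorial_le hc ht k) (haR _) (ha _) (by positivity)
  have h2 : Real.exp (-c * t) * Real.exp (c / 2 * t) = Real.exp (-(c / 2) * t) := by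
    rw [← Real.exp_add]; ring_nf
  calc freeResponse c a N i t
      ≤ Real.exp (-c * t) * ∑ k ∈ Finset.range n, (2 / c) ^ k * Real.exp (c / 2 * t) * R :=
        mul_le_mul_of_nonneg_left h1 (Real.exp_pos _).le
    _ = (∑ k ∈ Finset.range n, (2 / c) ^ k) * R *
          (Real.exp (-c * t) * Real.exp (c / 2 * t)) := by
        rw [Finset.sum_mul, Finset.sum_mul, Finset.mul_sum]
        refine Finset.sum_congr rfl fun k _ => by ring
    _ = _ := by rw [h2]

/-! ### Convergence from a dissipation inequality -/

/-- A quantitative Barbalat argument. From time u, f stays above the line of slope -K through (u, f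
u), so over a time f(u)/K the function U loses at least k f(u)²/(2K). As U converges, its losses
tend to zero, and so does f². -/
theorem tendsto_zero_of_dissipation {U f : ℝ → ℝ} {t₀ k K : ℝ} (hk : 0 < k) (hK : 0 < K)
    (hU : ContinuousOn U (Set.Ici t₀)) (hf : ContinuousOn f (Set.Ici t₀))
    (hU0 : ∀ t, t₀ ≤ t → 0 ≤ U t) (hf0 : ∀ t, t₀ ≤ t → 0 ≤ f t)
    (hd : ∀ b, t₀ ≤ b → ∃ D : Set ℝ, D.Finite ∧ ∀ t ∈ Set.Ioo t₀ b \ D,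
      (∃ U' ≤ -k * f t, HasDerivAt U U' t) ∧ ∃ f', |f'| ≤ K ∧ HasDerivAt f f' t) :
    Tendsto f atTop (𝓝 0) := by
  have hanti : ∀ u v, t₀ ≤ u → u ≤ v → U v ≤ U u := by
    intro u v hu huv
    obtain ⟨D, hD, hd'⟩ := hd v (hu.trans huv)
    refine le_of_deriv_nonpos_off_finite hD huv (hU.mono fun t ht => hu.trans ht.1) ?_
    rintro t ⟨ht, htD⟩
    obtain ⟨⟨U', hU', h⟩, -⟩ := hd' t ⟨⟨hu.trans_lt ht.1, ht.2⟩, htD⟩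
    refine ⟨U', hU'.trans ?_, h⟩
    nlinarith [hf0 t (hu.trans ht.1.le)]
  have hlow : ∀ u t, t₀ ≤ u → u ≤ t → f u - K * (t - u) ≤ f t := by
    intro u t hu hut
    obtain ⟨D, hD, hd'⟩ := hd t (hu.trans hut)
    have hlin : ∀ v, HasDerivAt (fun v : ℝ => K * (v - u)) K v := fun v => by
      simpa using ((hasDerivAt_id v).sub_const u).const_mul K
    have := le_of_deriv_nonpos_off_finite (f := fun v => -f v - K * (v - u)) hD hut
      ((hf.mono fun t ht => hu.trans ht.1).neg.sub
        fun v _ => (hlin v).continuousAt.continuousWithinAt) ?_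
    · linarith
    · rintro v ⟨hv, hvD⟩
      obtain ⟨-, f', hf', h⟩ := hd' v ⟨⟨hu.trans_lt hv.1, hv.2⟩, hvD⟩
      exact ⟨_, by linarith [abs_le.1 hf'], h.neg.sub (hlin v)⟩
  -- The quadratic added to U below is k times the integral of the line bounding f from below.
  have hdrop : ∀ u, t₀ ≤ u → f u ^ 2 ≤ 2 * K / k * (U u - U (u + f u / K)) := by
    intro u hu
    have hfu := hf0 u hu
    have huv : u ≤ u + f u / K := le_add_of_nonneg_right (by positivity)
    obtain ⟨D, hD, hd'⟩ := hd _ (hu.trans huv)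
    have hq : ∀ v, HasDerivAt (fun v : ℝ => k * (f u * (v - u) - K * (v - u) ^ 2 / 2))
        (k * (f u - K * (v - u))) v := fun v => by
      have h1 := (hasDerivAt_id v).sub_const u
      refine (((h1.const_mul (f u)).sub (((h1.pow 2).const_mul K).div_const 2)).const_mul
        k).congr_deriv ?_
      simp only [id]
      ring
    have := le_of_deriv_nonpos_off_finite
      (f := fun v => U v + k * (f u * (v - u) - K * (v - u) ^ 2 / 2)) hD huv
      ((hU.mono fun t ht => hu.trans ht.1).add
        fun v _ => (hq v).continuousAt.continuousWithinAt) ?_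
    · simp only [add_sub_cancel_left, sub_self] at this
      have e : k * (f u * (f u / K) - K * (f u / K) ^ 2 / 2) = k / (2 * K) * f u ^ 2 := by
        field_simp; ring
      rw [e] at this
      have h2 : k / (2 * K) * f u ^ 2 ≤ U u - U (u + f u / K) := by linarith
      calc f u ^ 2 = 2 * K / k * (k / (2 * K) * f u ^ 2) := by field_simp
        _ ≤ _ := by gcongr
    · rintro v ⟨hv, hvD⟩
      obtain ⟨⟨U', hU', h⟩, -⟩ := hd' v ⟨⟨hu.trans_lt hv.1, hv.2⟩, hvD⟩
      refine ⟨_, ?_, h.add (hq v)⟩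
      nlinarith [hlow u v hu hv.1.le]
  -- Freezing U before `t₀` makes it antitone on all of ℝ.
  have hlim : ∃ L, Tendsto (fun t => U (max t t₀)) atTop (𝓝 L) ∧ ∀ t, L ≤ U (max t t₀) := by
    have ha : Antitone fun t => U (max t t₀) := fun x y hxy =>
      hanti _ _ (le_max_right _ _) (max_le_max_right _ hxy)
    have hb : BddBelow (Set.range fun t => U (max t t₀)) :=
      ⟨0, by rintro _ ⟨t, rfl⟩; exact hU0 _ (le_max_right _ _)⟩
    exact ⟨_, tendsto_atTop_ciInf ha hb, fun t => ciInf_le hb t⟩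
  obtain ⟨L, hL, hLle⟩ := hlim
  have hsq : Tendsto (fun t => f t ^ 2) atTop (𝓝 0) := by
    have h1 : Tendsto (fun t => 2 * K / k * (U (max t t₀) - L)) atTop (𝓝 0) := by
      simpa using (hL.sub_const L).const_mul (2 * K / k)
    refine tendsto_of_tendsto_of_tendsto_of_le_of_le' tendsto_const_nhds h1
      (Eventually.of_forall fun t => sq_nonneg _) ?_
    filter_upwards [eventually_ge_atTop t₀] with t ht
    refine (hdrop t ht).trans ?_
    have h2 := hLle (t + f t / K)
    rw [max_eq_left (ht.trans (le_add_of_nonneg_right (div_nonneg (hf0 t ht) hK.le)))] at h2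
    rw [max_eq_left ht]
    gcongr
  have := hsq.sqrt
  rw [Real.sqrt_zero] at this
  refine this.congr' ?_
  filter_upwards [eventually_ge_atTop t₀] with t ht
  exact Real.sqrt_sq (hf0 t ht)

end

/-! ### The controller: smoothness, triangular structure, and gains that dominate the regressors -/

section

variable {n p : ℕ}

/-! ### Euclidean norms -/

theorem vnorm_nonneg {m : ℕ} (v : Vec m) : 0 ≤ vnorm v := norm_nonneg _

theorem vnorm_sq {m : ℕ} (v : Vec m) : vnorm v ^ 2 = ∑ i, v i ^ 2 := by
  rw [vnorm, EuclideanSpace.real_norm_sq_eq]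

theorem abs_le_vnorm {m : ℕ} (v : Vec m) (i : Fin m) : |v i| ≤ vnorm v := by
  refine abs_le_of_sq_le_sq ?_ (vnorm_nonneg v)
  rw [vnorm_sq]
  exact Finset.single_le_sum (f := fun i => v i ^ 2) (fun _ _ => sq_nonneg _) (Finset.mem_univ i)

theorem norm_le_vnorm {m : ℕ} (v : Vec m) : ‖v‖ ≤ vnorm v :=
  (pi_norm_le_iff_of_nonneg (vnorm_nonneg v)).2 (abs_le_vnorm v)

theorem vnorm_le_of_abs_le {m : ℕ} {v : Vec m} {B : ℝ} (h : ∀ i, |v i| ≤ B) :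
    vnorm v ≤ √(m * B ^ 2) := by
  refine Real.le_sqrt_of_sq_le ?_
  rw [vnorm_sq]
  calc ∑ i, v i ^ 2 ≤ ∑ _i : Fin m, B ^ 2 :=
        Finset.sum_le_sum fun i _ => sq_le_sq.2 ((h i).trans (le_abs_self B))
    _ = _ := by simp

theorem dotProduct_le_vnorm {m : ℕ} (v u : Vec m) : |v ⬝ᵥ u| ≤ vnorm v * vnorm u := by
  have h := abs_real_inner_le_norm (WithLp.toLp 2 u : EuclideanSpace ℝ (Fin m)) (WithLp.toLp 2 v)
  rw [EuclideanSpace.inner_toLp_toLp] at h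
  rw [mul_comm]
  simpa [vnorm] using h

theorem contDiff_vnorm_sq {E : Type*} [NormedAddCommGroup E] [NormedSpace ℝ E] {m : ℕ}
    {f : E → Vec m} (hf : ContDiff ℝ ∞ f) : ContDiff ℝ ∞ fun q => vnorm (f q) ^ 2 := by
  simp only [vnorm_sq]
  exact ContDiff.sum fun i _ => (contDiff_pi.1 hf i).pow 2

theorem contDiff_dotProduct {E : Type*} [NormedAddCommGroup E] [NormedSpace ℝ E] {m : ℕ}
    {f g : E → Vec m} (hf : ContDiff ℝ ∞ f) (hg : ContDiff ℝ ∞ g) :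
    ContDiff ℝ ∞ fun q => f q ⬝ᵥ g q :=
  ContDiff.sum fun i _ => (contDiff_pi.1 hf i).mul (contDiff_pi.1 hg i)

theorem contDiff_fderiv_const {E : Type*} [NormedAddCommGroup E] [NormedSpace ℝ E] {f : E → ℝ}
    (hf : ContDiff ℝ ∞ f) (v : E) : ContDiff ℝ ∞ fun q => fderiv ℝ f q v :=
  (hf.fderiv_right (m := ∞) le_rfl).clm_apply contDiff_const

/-! ### Smoothness of the controller -/

/-- The entry of `v` with index `k`, and `0` beyond the range of indices. -/
def entry (v : Vec n) (k : ℕ) : ℝ := if hk : k < n then v ⟨k, hk⟩ else 0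

theorem entry_val (v : Vec n) (i : Fin n) : entry v i.val = v i := by simp [entry]

theorem contDiff_entry {E : Type*} [NormedAddCommGroup E] [NormedSpace ℝ E]
    {f : E → Vec n} (hf : ContDiff ℝ ∞ f) (k : ℕ) : ContDiff ℝ ∞ fun q => entry (f q) k := by
  unfold entry
  split_ifs with h
  exacts [contDiff_pi.1 hf _, contDiff_const]

section Smooth

variable {φ : Fin n → Vec n → Vec p} {a : Pt n p → ℝ}

theorem contDiff_dX (ha : ContDiff ℝ ∞ a) (k : Fin n) : ContDiff ℝ ∞ fun q => dX a q k :=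
  contDiff_fderiv_const ha _

theorem contDiff_dR (ha : ContDiff ℝ ∞ a) (k : Fin n) : ContDiff ℝ ∞ fun q => dR a q k :=
  contDiff_fderiv_const ha _

theorem contDiff_dTheta (ha : ContDiff ℝ ∞ a) : ContDiff ℝ ∞ fun q => dTheta a q :=
  contDiff_pi.2 fun _ => contDiff_fderiv_const ha _

theorem contDiff_wOf (hφ : ∀ i, ContDiff ℝ ∞ (φ i)) (ha : ContDiff ℝ ∞ a) (i : Fin n) :
    ContDiff ℝ ∞ (wOf φ a i) :=
  ((hφ i).comp contDiff_fst).sub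
    (ContDiff.sum fun k _ => (contDiff_dX ha k).smul ((hφ k).comp contDiff_fst))

theorem contDiff_sOf (d : Design n p) (hφ : ∀ i, ContDiff ℝ ∞ (φ i)) (ha : ContDiff ℝ ∞ a)
    (i : Fin n) : ContDiff ℝ ∞ (sOf d φ a i) :=
  (contDiff_const.add (contDiff_const.mul (contDiff_vnorm_sq (contDiff_wOf hφ ha i)))).add
    (contDiff_const.mul (contDiff_vnorm_sq (contDiff_dTheta ha)))

theorem contDiff_driftOf (ha : ContDiff ℝ ∞ a) (i : Fin n) : ContDiff ℝ ∞ (driftOf a i) := by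
  refine ContDiff.sum fun k _ => ((contDiff_dX ha k).mul ?_).add ((contDiff_dR ha k).mul ?_)
  exacts [contDiff_entry contDiff_fst _, contDiff_entry (contDiff_fst.comp contDiff_snd) _]

/-- Each virtual control contains first derivatives of the preceding one, so the induction is run in
the smooth class, where no derivative is lost. -/
theorem contDiff_alpha (d : Design n p) (hφ : ∀ i, ContDiff ℝ ∞ (φ i)) (j : ℕ) :
    ContDiff ℝ ∞ (alpha d φ j) := by
  induction j with
  | zero => exact contDiff_const
  | succ j ih =>
    rw [alpha]
    split_ifs with hj
    · have hx : ContDiff ℝ ∞ fun q : Pt n p => q.1 ⟨j, hj⟩ := contDiff_pi.1 contDiff_fst _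
      have hr : ContDiff ℝ ∞ fun q : Pt n p => q.2.1 ⟨j, hj⟩ :=
        contDiff_pi.1 (contDiff_fst.comp contDiff_snd) _
      exact (((contDiff_sOf d hφ ih _).mul ((hx.sub ih).sub hr)).neg.sub
        (contDiff_dotProduct (contDiff_wOf hφ ih _) (contDiff_snd.comp contDiff_snd))).add
        (contDiff_driftOf ih _)
    · exact contDiff_const

theorem contDiff_hErr (d : Design n p) (hφ : ∀ i, ContDiff ℝ ∞ (φ i)) :
    ContDiff ℝ ∞ (hErr d φ) :=
  contDiff_pi.2 fun i => ((contDiff_pi.1 contDiff_fst i).sub (contDiff_alpha d hφ _)).sub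
    (contDiff_pi.1 (contDiff_fst.comp contDiff_snd) i)

theorem contDiff_w (d : Design n p) (hφ : ∀ i, ContDiff ℝ ∞ (φ i)) (i : Fin n) :
    ContDiff ℝ ∞ fun q => w d φ q i := contDiff_wOf hφ (contDiff_alpha d hφ _) i

theorem contDiff_s (d : Design n p) (hφ : ∀ i, ContDiff ℝ ∞ (φ i)) (i : Fin n) :
    ContDiff ℝ ∞ fun q => s d φ q i := contDiff_sOf d hφ (contDiff_alpha d hφ _) i

end Smooth

/-! ### The triangular structure of the virtual controls -/

/-- The linear map that deletes the entries of a vector with index at least `m`. -/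
def cutVec (n m : ℕ) : Vec n →L[ℝ] Vec n :=
  ContinuousLinearMap.pi fun k => if k.val < m then ContinuousLinearMap.proj k else 0

theorem cutVec_apply (m : ℕ) (v : Vec n) (k : Fin n) :
    cutVec n m v k = if k.val < m then v k else 0 := by
  rw [cutVec, ContinuousLinearMap.pi_apply]
  split_ifs <;> simp

theorem cutVec_single (m : ℕ) (k : Fin n) :
    cutVec n m (Pi.single k 1) = if k.val < m then Pi.single k 1 else 0 := by
  ext l
  rw [cutVec_apply]
  by_cases hlk : l = k
  · subst hlk
    split_ifs <;> simp
  · split_ifs <;> simp [hlk]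

/-- The linear map that deletes the entries of `x` and `r` with index at least `m`. -/
def cut (n p m : ℕ) : Pt n p →L[ℝ] Pt n p :=
  (cutVec n m).prodMap ((cutVec n m).prodMap (ContinuousLinearMap.id ℝ (Vec p)))

theorem cut_apply (m : ℕ) (q : Pt n p) :
    cut n p m q = (cutVec n m q.1, cutVec n m q.2.1, q.2.2) := rfl

theorem cut_cut {m m' : ℕ} (h : m ≤ m') (q : Pt n p) : cut n p m (cut n p m' q) = cut n p m q := by
  have : ∀ v : Vec n, cutVec n m (cutVec n m' v) = cutVec n m v := by
    intro v
    ext k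
    simp only [cutVec_apply]
    split_ifs <;> first | rfl | omega
  simp only [cut_apply, this]

section Cut

variable {m : ℕ} {f : Pt n p → ℝ} (hf : ContDiff ℝ ∞ f) (hcut : ∀ q, f q = f (cut n p m q))
include hf hcut

/-- Chain rule for f = f ∘ `cut`. It makes the partial derivatives beyond index `m` vanish and the
remaining ones again independent of the deleted entries. -/
theorem fderiv_cut (q v : Pt n p) : fderiv ℝ f q v = fderiv ℝ f (cut n p m q) (cut n p m v) := by
  have h1 : HasFDerivAt (f ∘ cut n p m) ((fderiv ℝ f (cut n p m q)).comp (cut n p m)) q :=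
    ((hf.differentiable (by simp)) _).hasFDerivAt.comp q (cut n p m).hasFDerivAt
  have h2 : f ∘ cut n p m = f := funext fun q => (hcut q).symm
  rw [h2] at h1
  rw [h1.fderiv]
  rfl

theorem dX_cut (q : Pt n p) (k : Fin n) :
    dX f q k = if k.val < m then dX f (cut n p m q) k else 0 := by
  rw [dX, fderiv_cut hf hcut, cut_apply m (Pi.single k 1, 0, 0)]
  simp only [cutVec_single, map_zero]
  split_ifs
  · rfl
  · exact map_zero _

theorem dR_cut (q : Pt n p) (k : Fin n) :
    dR f q k = if k.val < m then dR f (cut n p m q) k else 0 := by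
  rw [dR, fderiv_cut hf hcut, cut_apply m (0, Pi.single k 1, 0)]
  simp only [cutVec_single, map_zero]
  split_ifs
  · rfl
  · exact map_zero _

theorem dTheta_cut (q : Pt n p) : dTheta f q = dTheta f (cut n p m q) := by
  ext j
  rw [dTheta, fderiv_cut hf hcut, cut_apply m (0, 0, Pi.single j 1)]
  simp only [map_zero]
  rfl

end Cut

/-- Strict feedback propagates: passing from α_m to α_{m+1} brings in only φ_1, …, φ_{m+1} and
entries of x and r with 1-based index at most m + 1. This keeps u out of the time derivatives of the
virtual controls used in h, and lets x be bounded one coordinate at a time. -/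
theorem alpha_cut (d : Design n p) {φ : Fin n → Vec n → Vec p} (hφ : ∀ i, ContDiff ℝ ∞ (φ i))
    (hsf : IsStrictFeedback φ) (m : ℕ) (q : Pt n p) :
    alpha d φ m q = alpha d φ m (cut n p m q) := by
  induction m generalizing q with
  | zero => rfl
  | succ m ih =>
    rw [alpha]
    split_ifs with hm
    swap
    · rfl
    have hs := contDiff_alpha d hφ m
    have hcc := cut_cut (Nat.le_succ m) q
    have hX : ∀ k, dX (alpha d φ m) (cut n p (m + 1) q) k = dX (alpha d φ m) q k := fun k => by
      rw [dX_cut hs ih (cut n p (m + 1) q), dX_cut hs ih q, hcc]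
    have hR : ∀ k, dR (alpha d φ m) (cut n p (m + 1) q) k = dR (alpha d φ m) q k := fun k => by
      rw [dR_cut hs ih (cut n p (m + 1) q), dR_cut hs ih q, hcc]
    have hT : dTheta (alpha d φ m) (cut n p (m + 1) q) = dTheta (alpha d φ m) q := by
      rw [dTheta_cut hs ih (cut n p (m + 1) q), dTheta_cut hs ih q, hcc]
    have hA : alpha d φ m (cut n p (m + 1) q) = alpha d φ m q := by
      rw [ih (cut n p (m + 1) q), ih q, hcc]
    have hφc : ∀ k : Fin n, k.val ≤ m → φ k (cut n p (m + 1) q).1 = φ k q.1 := fun k hk =>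
      hsf k _ _ fun j hj => by
        refine (cutVec_apply _ _ _).trans (if_pos ?_)
        have : j.val ≤ k.val := hj
        omega
    have hv : ∀ v : Vec n, cutVec n (m + 1) v ⟨m, hm⟩ = v ⟨m, hm⟩ := fun v => by
      rw [cutVec_apply, if_pos (Nat.lt_succ_self m)]
    -- The drift reads entry `k + 1 ≤ m`, which survives a cut at `m + 1`.
    have hsucc : ∀ (v : Vec n) (k : Fin n), k < ⟨m, hm⟩ →
        succCoord (cutVec n (m + 1) v) 0 k = succCoord v 0 k := fun v k hk => by
      have hk' : k.val < m := hk
      have : k.val + 1 < n := by omega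
      simp only [succCoord, dif_pos this, cutVec_apply]
      rw [if_pos]
      simpa using hk'
    have hW : wOf φ (alpha d φ m) ⟨m, hm⟩ (cut n p (m + 1) q) = wOf φ (alpha d φ m) ⟨m, hm⟩ q := by
      rw [wOf, wOf, hφc _ le_rfl]
      congr 1
      refine Finset.sum_congr rfl fun k hk => ?_
      rw [hX, hφc k (Finset.mem_Iio.1 hk).le]
    have hS : sOf d φ (alpha d φ m) ⟨m, hm⟩ (cut n p (m + 1) q)
        = sOf d φ (alpha d φ m) ⟨m, hm⟩ q := by
      rw [sOf, sOf, hW, hT]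
    have hDr : driftOf (alpha d φ m) ⟨m, hm⟩ (cut n p (m + 1) q)
        = driftOf (alpha d φ m) ⟨m, hm⟩ q := by
      refine Finset.sum_congr rfl fun k hk => ?_
      rw [hX, hR, cut_apply, hsucc _ k (Finset.mem_Iio.1 hk), hsucc _ k (Finset.mem_Iio.1 hk)]
    simp only [hW, hS, hDr, hA]
    simp only [cut_apply, hv]

/-! ### Gains dominate the regressors -/

/-- The AM-GM inequality 2√(ck) v ≤ c + k v². It is the reason for the nonlinear damping terms in
s_i and the source of the square roots in h₁*. -/
theorem le_div_two_sqrt {c k v S : ℝ} (hc : 0 < c) (hk : 0 < k) (h : c + k * v ^ 2 ≤ S) :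
    v ≤ S * (1 / √(c * k) / 2) := by
  have hr : 0 < √(c * k) := Real.sqrt_pos.2 (mul_pos hc hk)
  have hsq : √(c * k) ^ 2 = c * k := Real.sq_sqrt (mul_pos hc hk).le
  have hAG : 2 * √(c * k) * v ≤ c + k * v ^ 2 := by
    have h1 : √c ^ 2 = c := Real.sq_sqrt hc.le
    have h2 : √k ^ 2 = k := Real.sq_sqrt hk.le
    rw [Real.sqrt_mul hc.le]
    nlinarith [sq_nonneg (√c - √k * v)]
  have : v = 2 * √(c * k) * v * (1 / √(c * k) / 2) := by field_simp
  rw [this]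
  gcongr
  exact hAG.trans h

section Gains

variable {d : Design n p} (hd : d.Admissible) (φ : Fin n → Vec n → Vec p) (q : Pt n p) (i : Fin n)
include hd

theorem c_le_s : d.c i ≤ s d φ q i := by
  have h1 := mul_nonneg (hd.κ_pos i).le (sq_nonneg (vnorm (wOf φ (alpha d φ i.val) i q)))
  have h2 := mul_nonneg (hd.g_pos i).le (sq_nonneg (vnorm (dTheta (alpha d φ i.val) q)))
  rw [s, sOf]
  linarith

theorem vnorm_w_le {c k : ℝ} (hc : 0 < c) (hk : 0 < k) (hci : c ≤ d.c i) (hki : k ≤ d.κ i) :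
    vnorm (w d φ q i) ≤ s d φ q i * (1 / √(c * k) / 2) := by
  refine le_div_two_sqrt hc hk ?_
  have h2 := mul_nonneg (hd.g_pos i).le (sq_nonneg (vnorm (dTheta (alpha d φ i.val) q)))
  have h3 := mul_le_mul_of_nonneg_right hki (sq_nonneg (vnorm (w d φ q i)))
  rw [s, sOf]
  change _ ≤ d.c i + d.κ i * vnorm (w d φ q i) ^ 2 + _
  linarith

theorem vnorm_dTheta_le {c k : ℝ} (hc : 0 < c) (hk : 0 < k) (hci : c ≤ d.c i) (hki : k ≤ d.g i) :
    vnorm (dTheta (alpha d φ i.val) q) ≤ s d φ q i * (1 / √(c * k) / 2) := by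
  refine le_div_two_sqrt hc hk ?_
  have h2 := mul_nonneg (hd.κ_pos i).le (sq_nonneg (vnorm (wOf φ (alpha d φ i.val) i q)))
  have h3 := mul_le_mul_of_nonneg_right hki (sq_nonneg (vnorm (dTheta (alpha d φ i.val) q)))
  rw [s, sOf]
  linarith

end Gains

theorem exists_pos_le {m : ℕ} {f : Fin m → ℝ} (h : ∀ i, 0 < f i) : ∃ c > 0, ∀ i, c ≤ f i := by
  rcases isEmpty_or_nonempty (Fin m) with he | he
  · exact ⟨1, one_pos, fun i => he.elim i⟩
  · obtain ⟨j, hj⟩ := Finite.exists_min f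
    exact ⟨f j, h j, hj⟩

end

/-! ### Differential equations of the error signals at a regular time -/

section

variable {n p : ℕ}

/-! ### Differentiation of finite sums -/

theorem hasDerivAt_dotProduct {m : ℕ} {f g : ℝ → Vec m} {f' g' : Vec m} {t : ℝ}
    (hf : ∀ i, HasDerivAt (fun t => f t i) (f' i) t)
    (hg : ∀ i, HasDerivAt (fun t => g t i) (g' i) t) :
    HasDerivAt (fun t => f t ⬝ᵥ g t) (f' ⬝ᵥ g t + f t ⬝ᵥ g') t := by
  have h := HasDerivAt.fun_sum (u := Finset.univ) fun i _ => (hf i).mul (hg i)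
  refine h.congr_deriv ?_
  rw [Finset.sum_add_distrib]
  rfl

theorem hasDerivAt_mulVec {m k : ℕ} {M : Matrix (Fin m) (Fin k) ℝ} {g : ℝ → Vec k} {g' : Vec k}
    {t : ℝ} (hg : ∀ i, HasDerivAt (fun t => g t i) (g' i) t) (i : Fin m) :
    HasDerivAt (fun t => (M *ᵥ g t) i) ((M *ᵥ g') i) t :=
  HasDerivAt.fun_sum (u := Finset.univ) fun j _ => (hg j).const_mul (M i j)

theorem fderiv_eq_sum_partials (f : Pt n p → ℝ) (q v : Pt n p) :
    fderiv ℝ f q v = ∑ k, dX f q k * v.1 k + ∑ k, dR f q k * v.2.1 k + dTheta f q ⬝ᵥ v.2.2 := by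
  have hsum : ∀ {m : ℕ} (u : Vec m) (L : Vec m →ₗ[ℝ] ℝ), L u = ∑ k, L (Pi.single k 1) * u k := by
    intro m u L
    conv_lhs => rw [pi_eq_sum_univ' u, map_sum]
    exact Finset.sum_congr rfl fun k _ => by rw [map_smul, smul_eq_mul, mul_comm]
  set L : Pt n p →ₗ[ℝ] ℝ := (fderiv ℝ f q).toLinearMap
  have h1 := hsum v.1 (L ∘ₗ LinearMap.inl ℝ _ _)
  have h2 := hsum v.2.1 (L ∘ₗ LinearMap.inr ℝ _ _ ∘ₗ LinearMap.inl ℝ _ _)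
  have h3 := hsum v.2.2 (L ∘ₗ LinearMap.inr ℝ _ _ ∘ₗ LinearMap.inr ℝ _ _)
  have hv : v = (v.1, 0, 0) + (0, v.2.1, 0) + (0, 0, v.2.2) := by
    refine Prod.ext ?_ (Prod.ext ?_ ?_) <;> simp
  have hL : fderiv ℝ f q v = L (v.1, 0, 0) + L (0, v.2.1, 0) + L (0, 0, v.2.2) := by
    conv_lhs => rw [hv]
    rw [map_add, map_add]
    rfl
  rw [hL]
  exact congrArg₂ _ (congrArg₂ _ h1 h2) h3

/-! ### Entries of the closed-loop matrices -/

/-- The value 0 of `entry` beyond the index range puts the last row, which has no superdiagonal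
entry, into the same form as the others. -/
theorem A_mulVec (d : Design n p) (φ : Fin n → Vec n → Vec p) (q : Pt n p) (v : Vec n)
    (i : Fin n) : (A d φ q *ᵥ v) i = -s d φ q i * v i + entry v (i.val + 1) := by
  have h1 : ∀ k : Fin n, A d φ q i k * v k =
      (if k = i then -s d φ q i * v i else 0) + if k.val = i.val + 1 then v k else 0 := by
    intro k
    rw [A, Matrix.of_apply]
    by_cases hk : k = i
    · subst hk
      simp
    · simp [hk]
  rw [Matrix.mulVec, dotProduct, Finset.sum_congr rfl fun k _ => h1 k, Finset.sum_add_distrib,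
    Finset.sum_ite_eq' Finset.univ i, if_pos (Finset.mem_univ i), entry]
  congr 1
  split_ifs with h
  · rw [Finset.sum_eq_single ⟨i.val + 1, h⟩]
    · simp
    · intro k _ hk
      rw [if_neg]
      exact fun h' => hk (Fin.ext h')
    · simp
  · refine Finset.sum_eq_zero fun k _ => if_neg ?_
    have := k.isLt
    omega

theorem W_transpose_mulVec (d : Design n p) (φ : Fin n → Vec n → Vec p) (q : Pt n p) (v : Vec p)
    (i : Fin n) : ((W d φ q)ᵀ *ᵥ v) i = w d φ q i ⬝ᵥ v := rfl

theorem Q_transpose_mulVec (d : Design n p) (φ : Fin n → Vec n → Vec p) (q : Pt n p) (v : Vec p)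
    (i : Fin n) : ((Q d φ q)ᵀ *ᵥ v) i = -(dTheta (alpha d φ i.val) q ⬝ᵥ v) := by
  rw [← neg_dotProduct]
  rfl

theorem entry_add (u v : Vec n) (k : ℕ) : entry (u + v) k = entry u k + entry v k := by
  unfold entry
  split_ifs <;> simp

theorem entry_sub (u v : Vec n) (k : ℕ) : entry (u - v) k = entry u k - entry v k := by
  unfold entry
  split_ifs <;> simp

theorem entry_neg (v : Vec n) (k : ℕ) : entry (-v) k = -entry v k := by
  unfold entry
  split_ifs <;> simp

theorem entry_transpose_mulVec (M : Matrix (Fin p) (Fin n) ℝ) (v : Vec p) (k : ℕ) :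
    entry (Mᵀ *ᵥ v) k = (fun j => entry (M j) k) ⬝ᵥ v := by
  unfold entry
  split_ifs
  · rfl
  · simp [dotProduct]

theorem alpha_succ (d : Design n p) (φ : Fin n → Vec n → Vec p) (q : Pt n p) (i : Fin n) :
    alpha d φ (i.val + 1) q = -(s d φ q i * hErr d φ q i) - w d φ q i ⬝ᵥ q.2.2
      + driftOf (alpha d φ i.val) i q := by
  rw [alpha, dif_pos i.isLt]
  rfl

/-! ### The closed loop at a regular time -/

/-- All differential equations of the closed loop and of the reference hold at time `t`. -/
structure SolvesAt (d : Design n p) (φ : Fin n → Vec n → Vec p) (θ : Vec p) (r : ℕ → ℝ → ℝ)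
    (z : ℝ → State n p) (t : ℝ) : Prop where
  plant : ∀ i, HasDerivAt (fun t => (z t).x i)
    (succCoord (z t).x (control d φ r t (z t)) i + φ i (z t).x ⬝ᵥ θ) t
  filter : ∀ i j, HasDerivAt (fun t => (z t).Ωᵀ i j)
    ((A d φ (pt r t (z t)) * (z t).Ωᵀ + (W d φ (pt r t (z t)))ᵀ) i j) t
  filter₀ : ∀ i, HasDerivAt (fun t => (z t).Ω₀ i)
    ((A d φ (pt r t (z t)) *ᵥ (z t).Ω₀ + (W d φ (pt r t (z t)))ᵀ *ᵥ (z t).θhat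
      - (Q d φ (pt r t (z t)))ᵀ *ᵥ updateLaw d φ r t (z t)) i) t
  update : ∀ j, HasDerivAt (fun t => (z t).θhat j) (updateLaw d φ r t (z t) j) t
  ref : ∀ k, k < n → HasDerivAt (r k) (r (k + 1) t) t

/-- `ε̃ = h + Ω₀ - Ωᵀ θ`, the part of `ε` that is not due to the parameter error. -/
def epsTilde (d : Design n p) (φ : Fin n → Vec n → Vec p) (θ : Vec p) (r : ℕ → ℝ → ℝ) (t : ℝ)
    (z : State n p) : Vec n := hAt d φ r t z + z.Ω₀ - z.Ωᵀ *ᵥ θ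

/-- `χ = Ω₀ - Ωᵀ θ̂`, so that `ε = h + χ`. -/
def chi (z : State n p) : Vec n := z.Ω₀ - z.Ωᵀ *ᵥ z.θhat

theorem eps_eq_epsTilde_add (d : Design n p) (φ : Fin n → Vec n → Vec p) (θ : Vec p)
    (r : ℕ → ℝ → ℝ) (t : ℝ) (z : State n p) :
    eps d φ r t z = epsTilde d φ θ r t z + z.Ωᵀ *ᵥ (θ - z.θhat) := by
  rw [eps, epsTilde, Matrix.mulVec_sub]
  abel

theorem eps_eq_hAt_add_chi (d : Design n p) (φ : Fin n → Vec n → Vec p)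
    (r : ℕ → ℝ → ℝ) (t : ℝ) (z : State n p) : eps d φ r t z = hAt d φ r t z + chi z := by
  rw [eps, chi, add_sub_assoc]

theorem transpose_inv_of_posDef {Γ : Matrix (Fin p) (Fin p) ℝ} (hΓ : Γ.PosDef) :
    (Γ⁻¹)ᵀ = Γ⁻¹ := by
  have := hΓ.inv.isHermitian
  rwa [Matrix.IsHermitian, Matrix.conjTranspose_eq_transpose_of_trivial] at this

theorem inv_mul_of_posDef {Γ : Matrix (Fin p) (Fin p) ℝ} (hΓ : Γ.PosDef) : Γ⁻¹ * Γ = 1 :=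
  Matrix.nonsing_inv_mul _ hΓ.det_pos.ne'.isUnit

namespace SolvesAt

variable {d : Design n p} {φ : Fin n → Vec n → Vec p} {θ : Vec p} {r : ℕ → ℝ → ℝ}
  {z : ℝ → State n p} {t : ℝ}

theorem hasDerivAt_Ω (h : SolvesAt d φ θ r z t) (j : Fin p) (i : Fin n) :
    HasDerivAt (fun t => (z t).Ω j i) (-s d φ (pt r t (z t)) i * (z t).Ω j i
      + entry ((z t).Ω j) (i.val + 1) + w d φ (pt r t (z t)) i j) t := by
  refine (h.filter i j).congr_deriv ?_
  rw [Matrix.add_apply, ← A_mulVec d φ (pt r t (z t)) ((z t).Ω j) i]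
  rfl

theorem hasDerivAt_Ω₀ (h : SolvesAt d φ θ r z t) (i : Fin n) :
    HasDerivAt (fun t => (z t).Ω₀ i) (-s d φ (pt r t (z t)) i * (z t).Ω₀ i
      + entry (z t).Ω₀ (i.val + 1) + w d φ (pt r t (z t)) i ⬝ᵥ (z t).θhat
      + dTheta (alpha d φ i.val) (pt r t (z t)) ⬝ᵥ updateLaw d φ r t (z t)) t := by
  refine (h.filter₀ i).congr_deriv ?_
  rw [Pi.sub_apply, Pi.add_apply, A_mulVec, W_transpose_mulVec, Q_transpose_mulVec, sub_neg_eq_add]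

theorem hasDerivAt_pt (h : SolvesAt d φ θ r z t) :
    HasDerivAt (fun t => pt r t (z t))
      ((fun i => succCoord (z t).x (control d φ r t (z t)) i + φ i (z t).x ⬝ᵥ θ,
        fun i => r (i.val + 1) t, updateLaw d φ r t (z t)) : Pt n p) t :=
  (hasDerivAt_pi.2 h.plant).prodMk
    ((hasDerivAt_pi.2 fun i : Fin n => h.ref i.val i.isLt).prodMk (hasDerivAt_pi.2 h.update))

variable (hφ : ∀ i, ContDiff ℝ ∞ (φ i)) (hsf : IsStrictFeedback φ)
include hφ hsf

/-- By triangularity only partial derivatives with index below `i` survive in the chain rule, so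
neither the control nor r^{(n)} appears. -/
theorem hasDerivAt_alpha (h : SolvesAt d φ θ r z t) (i : Fin n) :
    HasDerivAt (fun t => alpha d φ i.val (pt r t (z t)))
      (driftOf (alpha d φ i.val) i (pt r t (z t))
        + (∑ k ∈ Finset.Iio i, dX (alpha d φ i.val) (pt r t (z t)) k • φ k (z t).x) ⬝ᵥ θ
        + dTheta (alpha d φ i.val) (pt r t (z t)) ⬝ᵥ updateLaw d φ r t (z t)) t := by
  have hs := contDiff_alpha d hφ i.val
  have hcut := alpha_cut d hφ hsf i.val
  have h1 := ((hs.differentiable (by simp)) (pt r t (z t))).hasFDerivAt.comp_hasDerivAt t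
    h.hasDerivAt_pt
  refine h1.congr_deriv ?_
  have hIio : ∀ F : Fin n → ℝ, (∀ k : Fin n, ¬ k.val < i.val → F k = 0) →
      ∑ k, F k = ∑ k ∈ Finset.Iio i, F k := fun F hF => by
    refine (Finset.sum_subset (Finset.subset_univ _) fun k _ hk => hF k fun hlt => hk ?_).symm
    exact Finset.mem_Iio.2 hlt
  rw [fderiv_eq_sum_partials, hIio _ fun k hk => by rw [dX_cut hs hcut, if_neg hk, zero_mul],
    hIio _ fun k hk => by rw [dR_cut hs hcut, if_neg hk, zero_mul]]
  congr 1
  rw [driftOf, ← Finset.sum_add_distrib, sum_dotProduct, ← Finset.sum_add_distrib]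
  refine Finset.sum_congr rfl fun k hk => ?_
  have hki : k.val < i.val := Fin.lt_def.1 (Finset.mem_Iio.1 hk)
  -- Hence the different fallback values of `succCoord` in the plant and in the drift are never
  -- reached.
  have hkn : k.val + 1 < n := by omega
  simp only [succCoord, dif_pos hkn, pt, smul_dotProduct, smul_eq_mul]
  ring

/-- The virtual control cancels the known drift and replaces w_iᵀθ by w_iᵀθ̃; the motion of the
estimate is left as a disturbance. -/
theorem hasDerivAt_hAt (h : SolvesAt d φ θ r z t) (i : Fin n) :
    HasDerivAt (fun t => hAt d φ r t (z t) i) (-s d φ (pt r t (z t)) i * hAt d φ r t (z t) i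
      + entry (hAt d φ r t (z t)) (i.val + 1) + w d φ (pt r t (z t)) i ⬝ᵥ (θ - (z t).θhat)
      - dTheta (alpha d φ i.val) (pt r t (z t)) ⬝ᵥ updateLaw d φ r t (z t)) t := by
  have h1 := ((h.plant i).sub (h.hasDerivAt_alpha hφ hsf i)).sub (h.ref i.val i.isLt)
  refine HasDerivAt.congr_deriv (f := fun t => hAt d φ r t (z t) i) h1 ?_
  -- In the last row this is the control law itself, with no further error coordinate.
  have hnext : succCoord (z t).x (control d φ r t (z t)) i - r (i.val + 1) t =
      entry (hAt d φ r t (z t)) (i.val + 1) + alpha d φ (i.val + 1) (pt r t (z t)) := by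
    unfold succCoord entry
    split_ifs with hi
    · simp only [hAt, hErr, pt]
      ring
    · have : i.val + 1 = n := by have := i.isLt; omega
      rw [control, this]
      ring
  have hα := alpha_succ d φ (pt r t (z t)) i
  have hw : w d φ (pt r t (z t)) i ⬝ᵥ θ = φ i (z t).x ⬝ᵥ θ
      - (∑ k ∈ Finset.Iio i, dX (alpha d φ i.val) (pt r t (z t)) k • φ k (z t).x) ⬝ᵥ θ := by
    rw [← sub_dotProduct]
    rfl
  have hθ : (pt r t (z t)).2.2 = (z t).θhat := rfl
  rw [hα, hθ] at hnext
  rw [dotProduct_sub, hw]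
  simp only [hAt] at hnext ⊢
  linarith

omit hφ hsf in
theorem hasDerivAt_Ω_mulVec (h : SolvesAt d φ θ r z t) {v : ℝ → Vec p} {v' : Vec p}
    (hv : ∀ j, HasDerivAt (fun t => v t j) (v' j) t) (i : Fin n) :
    HasDerivAt (fun t => ((z t).Ωᵀ *ᵥ v t) i) (-s d φ (pt r t (z t)) i * ((z t).Ωᵀ *ᵥ v t) i
      + entry ((z t).Ωᵀ *ᵥ v t) (i.val + 1) + w d φ (pt r t (z t)) i ⬝ᵥ v t
      + ((z t).Ωᵀ *ᵥ v') i) t := by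
  have h1 := hasDerivAt_dotProduct (fun j => h.hasDerivAt_Ω j i) hv
  refine h1.congr_deriv ?_
  rw [entry_transpose_mulVec]
  congr 1
  simp only [dotProduct, Matrix.mulVec, Matrix.transpose_apply, Finset.mul_sum,
    ← Finset.sum_add_distrib]
  exact Finset.sum_congr rfl fun j _ => by ring

/-- All forcing cancels: w_iᵀθ̃ + w_iᵀθ̂ - w_iᵀθ = 0, and the term with ∂α_{i-1}/∂θ̂ enters h and Ω₀
with opposite signs. -/
theorem hasDerivAt_epsTilde (h : SolvesAt d φ θ r z t) (i : Fin n) :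
    HasDerivAt (fun t => epsTilde d φ θ r t (z t) i) (-s d φ (pt r t (z t)) i
      * epsTilde d φ θ r t (z t) i + entry (epsTilde d φ θ r t (z t)) (i.val + 1)) t := by
  have h1 := ((h.hasDerivAt_hAt hφ hsf i).add (h.hasDerivAt_Ω₀ i)).sub
    (h.hasDerivAt_Ω_mulVec (v := fun _ => θ) (v' := 0) (fun j => hasDerivAt_const t (θ j)) i)
  refine HasDerivAt.congr_deriv (f := fun t => epsTilde d φ θ r t (z t) i) h1 ?_
  rw [epsTilde, entry_sub, entry_add, Matrix.mulVec_zero, dotProduct_sub]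
  simp only [Pi.sub_apply, Pi.add_apply, Pi.zero_apply]
  ring

omit hφ hsf in
-- The regressor cancels between Ω₀ and Ωᵀθ̂, so χ is driven by the update law alone and tends to
-- zero with it.
theorem hasDerivAt_chi (h : SolvesAt d φ θ r z t) (i : Fin n) :
    HasDerivAt (fun t => chi (z t) i) (-s d φ (pt r t (z t)) i * chi (z t) i
      + entry (chi (z t)) (i.val + 1)
      + dTheta (alpha d φ i.val) (pt r t (z t)) ⬝ᵥ updateLaw d φ r t (z t)
      - ((z t).Ωᵀ *ᵥ updateLaw d φ r t (z t)) i) t := by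
  have h1 := (h.hasDerivAt_Ω₀ i).sub (h.hasDerivAt_Ω_mulVec h.update i)
  refine HasDerivAt.congr_deriv (f := fun t => chi (z t) i) h1 ?_
  rw [chi, entry_sub]
  simp only [Pi.sub_apply]
  ring

omit hφ hsf in
theorem hasDerivAt_thetaTilde (h : SolvesAt d φ θ r z t) (j : Fin p) :
    HasDerivAt (fun t => (θ - (z t).θhat) j) ((-updateLaw d φ r t (z t)) j) t :=
  (h.update j).const_sub (θ j)

omit hφ hsf in
-- The weight Γ⁻¹ cancels the adaptation gain in the update law; symmetry of Γ⁻¹ merges the two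
-- product-rule terms.
theorem hasDerivAt_lyapunov (hd : d.Admissible) (h : SolvesAt d φ θ r z t) :
    HasDerivAt (fun t => (θ - (z t).θhat) ⬝ᵥ (d.Γ⁻¹ *ᵥ (θ - (z t).θhat)))
      (-2 * (1 + d.ν * frobSq (z t).Ω)⁻¹ *
        (((z t).Ωᵀ *ᵥ (θ - (z t).θhat)) ⬝ᵥ eps d φ r t (z t))) t := by
  have h1 := hasDerivAt_dotProduct h.hasDerivAt_thetaTilde
    (fun j => hasDerivAt_mulVec (M := d.Γ⁻¹) h.hasDerivAt_thetaTilde j)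
  refine h1.congr_deriv ?_
  have hinv : d.Γ⁻¹ *ᵥ updateLaw d φ r t (z t) =
      (1 + d.ν * frobSq (z t).Ω)⁻¹ • ((z t).Ω *ᵥ eps d φ r t (z t)) := by
    rw [updateLaw, Matrix.mulVec_smul, Matrix.mulVec_mulVec,
      inv_mul_of_posDef hd.Γ_pos, Matrix.one_mulVec]
  have hswap : (-updateLaw d φ r t (z t)) ⬝ᵥ d.Γ⁻¹ *ᵥ (θ - (z t).θhat) =
      (θ - (z t).θhat) ⬝ᵥ d.Γ⁻¹ *ᵥ (-updateLaw d φ r t (z t)) := by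
    rw [dotProduct_comm, Matrix.dotProduct_mulVec (θ - (z t).θhat), ← Matrix.mulVec_transpose,
      transpose_inv_of_posDef hd.Γ_pos]
  rw [hswap, Matrix.mulVec_neg, hinv, dotProduct_neg, dotProduct_smul, Matrix.dotProduct_mulVec,
    ← Matrix.mulVec_transpose, smul_eq_mul]
  ring

end SolvesAt

end

/-! ### Regular times, vector cascades and the calculus of uniform bounds -/

section

variable {n p : ℕ}

/-! ### Regular times of a solution -/

theorem IsHorizon.subset_Ici {t₀ : ℝ} {J : Set ℝ} (hJ : IsHorizon t₀ J) : J ⊆ Set.Ici t₀ := by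
  rcases hJ with rfl | ⟨T, rfl⟩
  exacts [subset_rfl, fun t ht => ht.1]

theorem IsHorizon.Icc_subset {t₀ b : ℝ} {J : Set ℝ} (hJ : IsHorizon t₀ J) (hb : b ∈ J) :
    Set.Icc t₀ b ⊆ J := by
  rcases hJ with rfl | ⟨T, rfl⟩
  exacts [fun t ht => ht.1, fun t ht => ⟨ht.1, ht.2.trans_lt hb.2⟩]

theorem HasPiecewiseDerivOn.exists_finite {f f' : ℝ → ℝ} {J : Set ℝ}
    (h : HasPiecewiseDerivOn f f' J) {a b : ℝ} (hb : b ∈ J) (hsub : Set.Icc a b ⊆ J) :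
    ∃ D : Set ℝ, D.Finite ∧ ∀ t ∈ Set.Ioo a b \ D, HasDerivAt f (f' t) t := by
  obtain ⟨-, D, hD, hd⟩ := h
  refine ⟨_, hD b hb, ?_⟩
  rintro t ⟨ht, htD⟩
  have htJ : t ∈ J := hsub ⟨ht.1.le, ht.2.le⟩
  exact (hd t ⟨htJ, fun h => htD ⟨⟨h, htJ⟩, ht.2.le⟩⟩).hasDerivAt
    (mem_of_superset (Icc_mem_nhds ht.1 ht.2) hsub)

theorem exists_common_finite {ι : Type*} [Finite ι] {f f' : ι → ℝ → ℝ} {J : Set ℝ}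
    (h : ∀ i, HasPiecewiseDerivOn (f i) (f' i) J) {a b : ℝ} (hb : b ∈ J)
    (hsub : Set.Icc a b ⊆ J) :
    ∃ D : Set ℝ, D.Finite ∧ ∀ t ∈ Set.Ioo a b \ D, ∀ i, HasDerivAt (f i) (f' i t) t := by
  choose D hD hd using fun i => (h i).exists_finite hb hsub
  exact ⟨⋃ i, D i, Set.finite_iUnion hD,
    fun t ht i => hd i t ⟨ht.1, fun h => ht.2 (Set.mem_iUnion.2 ⟨i, h⟩)⟩⟩

theorem IsReference.hasPiecewiseDerivOn {r : ℕ → ℝ → ℝ} (hr : IsReference n r) (k : ℕ)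
    (hk : k < n) : HasPiecewiseDerivOn (r k) (r (k + 1)) (Set.Ici 0) := by
  by_cases h : k + 1 < n
  · exact ⟨fun t ht => (hr.deriv_lt k h t ht).continuousWithinAt, ∅,
      fun b _ => by simp, fun t ht => hr.deriv_lt k h t ht.1⟩
  · obtain rfl : k + 1 = n := by omega
    exact hr.deriv_last k rfl

theorem State.exists_boundedBy (z : State n p) : ∃ R, z.BoundedBy R :=
  ⟨max (vnorm z.x) (max (vnorm z.θhat) (max (√(frobSq z.Ω)) (vnorm z.Ω₀))),
    by simp, by simp, by simp, by simp⟩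

/-- A solution from time `t₀ ≥ 0` on the interval `J` with initial state bounded by `R`. -/
structure IsTrajectory (d : Design n p) (φ : Fin n → Vec n → Vec p) (θ : Vec p)
    (r : ℕ → ℝ → ℝ) (R t₀ : ℝ) (J : Set ℝ) (z : ℝ → State n p) : Prop where
  nonneg : 0 ≤ t₀
  horizon : IsHorizon t₀ J
  sol : IsSolution d φ θ r J z
  init : (z t₀).BoundedBy R

variable {d : Design n p} {φ : Fin n → Vec n → Vec p} {θ : Vec p} {r : ℕ → ℝ → ℝ} {R : ℝ}

namespace IsTrajectory

variable {t₀ : ℝ} {J : Set ℝ} {z : ℝ → State n p}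

theorem start_le (h : IsTrajectory d φ θ r R t₀ J z) {t : ℝ} (ht : t ∈ J) : t₀ ≤ t :=
  h.horizon.subset_Ici ht

theorem time_nonneg (h : IsTrajectory d φ θ r R t₀ J z) {t : ℝ} (ht : t ∈ J) : 0 ≤ t :=
  h.nonneg.trans (h.start_le ht)

theorem exists_solvesAt (hr : IsReference n r) (h : IsTrajectory d φ θ r R t₀ J z) {b : ℝ}
    (hb : b ∈ J) :
    ∃ D : Set ℝ, D.Finite ∧ ∀ t ∈ Set.Ioo t₀ b \ D, SolvesAt d φ θ r z t := by
  have hsub := h.horizon.Icc_subset hb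
  obtain ⟨D₁, hD₁, h₁⟩ := exists_common_finite h.sol.plant hb hsub
  obtain ⟨D₂, hD₂, h₂⟩ := exists_common_finite (ι := Fin n × Fin p)
    (fun k => h.sol.filter k.1 k.2) hb hsub
  obtain ⟨D₃, hD₃, h₃⟩ := exists_common_finite h.sol.filter₀ hb hsub
  obtain ⟨D₄, hD₄, h₄⟩ := exists_common_finite h.sol.update hb hsub
  obtain ⟨D₅, hD₅, h₅⟩ := exists_common_finite (ι := Fin n)
    (fun k => hr.hasPiecewiseDerivOn k.val k.isLt) (a := t₀) (b := b) (h.time_nonneg hb)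
    fun t ht => h.nonneg.trans ht.1
  refine ⟨D₁ ∪ D₂ ∪ D₃ ∪ D₄ ∪ D₅, (((hD₁.union hD₂).union hD₃).union hD₄).union hD₅, ?_⟩
  rintro t ⟨ht, hD⟩
  simp only [Set.mem_union, not_or] at hD
  obtain ⟨⟨⟨⟨n₁, n₂⟩, n₃⟩, n₄⟩, n₅⟩ := hD
  exact ⟨h₁ t ⟨ht, n₁⟩, fun i j => h₂ t ⟨ht, n₂⟩ (i, j), h₃ t ⟨ht, n₃⟩, h₄ t ⟨ht, n₄⟩,
    fun k hk => h₅ t ⟨ht, n₅⟩ ⟨k, hk⟩⟩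

theorem continuousOn_Ω (h : IsTrajectory d φ θ r R t₀ J z) (j : Fin p) (i : Fin n) :
    ContinuousOn (fun t => (z t).Ω j i) J := (h.sol.filter i j).1

theorem continuousOn_Ω_mulVec (h : IsTrajectory d φ θ r R t₀ J z) {v : ℝ → Vec p}
    (hv : ∀ j, ContinuousOn (fun t => v t j) J) (i : Fin n) :
    ContinuousOn (fun t => ((z t).Ωᵀ *ᵥ v t) i) J :=
  continuousOn_finsetSum Finset.univ fun j _ => (h.continuousOn_Ω j i).mul (hv j)

theorem continuousOn_pt (hr : IsReference n r) (h : IsTrajectory d φ θ r R t₀ J z) :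
    ContinuousOn (fun t => pt r t (z t)) J :=
  (continuousOn_pi.2 fun i => (h.sol.plant i).1).prodMk
    ((continuousOn_pi.2 fun i : Fin n => (hr.hasPiecewiseDerivOn i.val i.isLt).1.mono
      fun _ ht => h.time_nonneg ht).prodMk (continuousOn_pi.2 fun j => (h.sol.update j).1))

theorem continuousOn_hAt (hφ : ∀ i, ContDiff ℝ ∞ (φ i)) (hr : IsReference n r)
    (h : IsTrajectory d φ θ r R t₀ J z) (i : Fin n) :
    ContinuousOn (fun t => hAt d φ r t (z t) i) J :=
  (((continuous_apply i).comp (contDiff_hErr d hφ).continuous).comp_continuousOn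
    (h.continuousOn_pt hr))

theorem continuousOn_epsTilde (hφ : ∀ i, ContDiff ℝ ∞ (φ i)) (hr : IsReference n r)
    (h : IsTrajectory d φ θ r R t₀ J z) (i : Fin n) :
    ContinuousOn (fun t => epsTilde d φ θ r t (z t) i) J :=
  ((h.continuousOn_hAt hφ hr i).add (h.sol.filter₀ i).1).sub
    (h.continuousOn_Ω_mulVec (v := fun _ => θ) (fun _ => continuousOn_const) i)

theorem continuousOn_chi (h : IsTrajectory d φ θ r R t₀ J z) (i : Fin n) :
    ContinuousOn (fun t => chi (z t) i) J :=
  (h.sol.filter₀ i).1.sub (h.continuousOn_Ω_mulVec (fun j => (h.sol.update j).1) i)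

theorem continuousOn_eps (hφ : ∀ i, ContDiff ℝ ∞ (φ i)) (hr : IsReference n r)
    (h : IsTrajectory d φ θ r R t₀ J z) (i : Fin n) :
    ContinuousOn (fun t => eps d φ r t (z t) i) J := by
  simp only [eps_eq_hAt_add_chi]
  exact (h.continuousOn_hAt hφ hr i).add (h.continuousOn_chi i)

theorem continuousOn_lyapunov (h : IsTrajectory d φ θ r R t₀ J z) :
    ContinuousOn (fun t => (θ - (z t).θhat) ⬝ᵥ (d.Γ⁻¹ *ᵥ (θ - (z t).θhat))) J := by
  have h1 : ∀ j, ContinuousOn (fun t => (θ - (z t).θhat) j) J := fun j =>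
    continuousOn_const.sub (h.sol.update j).1
  exact continuousOn_finsetSum Finset.univ fun j _ => (h1 j).mul
    (continuousOn_finsetSum Finset.univ fun k _ => continuousOn_const.mul (h1 k))

end IsTrajectory

/-! ### Cascades driven by disturbances that the gains dominate -/

section Cascade

variable {c M t₀ b : ℝ} {D : Set ℝ} {ξ S e : ℝ → Vec n} {a : Vec n}

/-- Vector form of `cascade_le`: extending by zero supplies its terminal condition ξ_n ≤ 0. -/
theorem cascade_apply_le (hc : 0 < c) (hM : 0 ≤ M) (hD : D.Finite)
    (hcont : ∀ i, ContinuousOn (fun t => ξ t i) (Set.Icc t₀ b)) (ha : ∀ i, 0 ≤ a i)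
    (h0 : ∀ i, ξ t₀ i ≤ a i)
    (hd : ∀ t ∈ Set.Ioo t₀ b \ D, ∀ i, c ≤ S t i ∧ e t i ≤ S t i * M ∧
      HasDerivAt (fun t => ξ t i) (-S t i * ξ t i + entry (ξ t) (i.val + 1) + e t i) t) :
    ∀ t ∈ Set.Icc t₀ b, ∀ i, ξ t i ≤
      freeResponse c (entry a) (n - i.val) i.val (t - t₀) + M * cascadeGain c (n - i.val) := by
  intro t ht i
  have hξ : ∀ i : Fin n, (fun t => entry (ξ t) i.val) = fun t => ξ t i := fun i =>
    funext fun t => entry_val _ _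
  have ha' : ∀ k, 0 ≤ entry a k := fun k => by
    unfold entry
    split_ifs
    exacts [ha _, le_rfl]
  rw [← entry_val (ξ t) i]
  refine cascade_le (n := n) (ξ := fun k t => entry (ξ t) k) (s := fun k t => entry (S t) k)
    hc hM hD ha' (fun k hk => ?_) (fun t => by simp [entry]) (fun k hk => ?_) (fun t ht k hk => ?_)
    (n - i.val) i.val (by have := i.isLt; omega) t ht
  · exact (hξ ⟨k, hk⟩).symm ▸ hcont ⟨k, hk⟩
  · simpa only [entry, dif_pos hk] using h0 ⟨k, hk⟩
  · obtain ⟨h1, h2, h3⟩ := hd t ht ⟨k, hk⟩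
    have hS : entry (S t) k = S t ⟨k, hk⟩ := dif_pos hk
    have hX : entry (ξ t) k = ξ t ⟨k, hk⟩ := dif_pos hk
    refine ⟨hS.symm ▸ h1, _, (hξ ⟨k, hk⟩).symm ▸ h3, ?_⟩
    simp only [hS, hX]
    linarith

/-- The one-sided estimate for ξ and for -ξ, each with the constant initial majorant `R`. -/
theorem cascade_abs_le (hc : 0 < c) (hM : 0 ≤ M) (hD : D.Finite)
    (hcont : ∀ i, ContinuousOn (fun t => ξ t i) (Set.Icc t₀ b)) (h0 : ∀ i, |ξ t₀ i| ≤ R)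
    (hd : ∀ t ∈ Set.Ioo t₀ b \ D, ∀ i, c ≤ S t i ∧ |e t i| ≤ S t i * M ∧
      HasDerivAt (fun t => ξ t i) (-S t i * ξ t i + entry (ξ t) (i.val + 1) + e t i) t) :
    ∀ t ∈ Set.Icc t₀ b, ∀ i, |ξ t i| ≤
      (∑ k ∈ Finset.range n, (2 / c) ^ k) * R * Real.exp (-(c / 2) * (t - t₀))
        + M * cascadeGain c n := by
  intro t ht i
  have hR : 0 ≤ R := (abs_nonneg _).trans (h0 i)
  have h1 := cascade_apply_le (a := fun _ => R) hc hM hD hcont (fun _ => hR)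
    (fun i => (abs_le.1 (h0 i)).2)
    (fun t ht i => ⟨(hd t ht i).1, (abs_le.1 (hd t ht i).2.1).2, (hd t ht i).2.2⟩) t ht i
  have h2 := cascade_apply_le (ξ := fun t => -ξ t) (S := S) (e := fun t => -e t)
    (a := fun _ => R) hc hM hD
    (fun i => (hcont i).neg) (fun _ => hR) (fun i => neg_le.1 (abs_le.1 (h0 i)).1)
    (fun t ht i => ⟨(hd t ht i).1, neg_le.1 (abs_le.1 (hd t ht i).2.1).1,
      (hd t ht i).2.2.neg.congr_deriv (by rw [entry_neg]; simp only [Pi.neg_apply]; ring)⟩) t ht i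
  have ha : ∀ k, 0 ≤ entry (fun _ : Fin n => R) k ∧ entry (fun _ : Fin n => R) k ≤ R := fun k => by
    unfold entry
    split_ifs
    exacts [⟨hR, le_rfl⟩, ⟨le_rfl, hR⟩]
  have h3 := freeResponse_le hc (fun k => (ha k).1) (fun k => (ha k).2) (Nat.sub_le n i.val) i.val
    (sub_nonneg.2 ht.1)
  have h4 := mul_le_mul_of_nonneg_left (cascadeGain_mono hc (Nat.sub_le n i.val)) hM
  simp only [Pi.neg_apply] at h2
  exact abs_le.2 ⟨by linarith, by linarith⟩

end Cascade

/-! ### Uniformly bounded signals -/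

/-- The signal `f` is bounded on the set of times and states described by `P`. -/
def UnifBdd (P : ℝ → State n p → Prop) (f : ℝ → State n p → ℝ) : Prop :=
  ∃ B, ∀ t z, P t z → |f t z| ≤ B

namespace UnifBdd

variable {P : ℝ → State n p → Prop} {f g : ℝ → State n p → ℝ}

theorem exists_nonneg (h : UnifBdd P f) : ∃ B, 0 ≤ B ∧ ∀ t z, P t z → |f t z| ≤ B := by
  obtain ⟨B, hB⟩ := h
  exact ⟨|B|, abs_nonneg B, fun t z hz => (hB t z hz).trans (le_abs_self B)⟩

theorem const (a : ℝ) : UnifBdd P fun _ _ => a := ⟨|a|, fun _ _ _ => le_rfl⟩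

theorem add (hf : UnifBdd P f) (hg : UnifBdd P g) : UnifBdd P fun t z => f t z + g t z := by
  obtain ⟨B, hB⟩ := hf
  obtain ⟨C, hC⟩ := hg
  exact ⟨B + C, fun t z h => (abs_add_le _ _).trans (add_le_add (hB t z h) (hC t z h))⟩

theorem neg (hf : UnifBdd P f) : UnifBdd P fun t z => -f t z := by
  simpa only [UnifBdd, abs_neg] using hf

theorem sub (hf : UnifBdd P f) (hg : UnifBdd P g) : UnifBdd P fun t z => f t z - g t z := by
  simpa only [sub_eq_add_neg] using hf.add hg.neg

theorem mul (hf : UnifBdd P f) (hg : UnifBdd P g) : UnifBdd P fun t z => f t z * g t z := by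
  obtain ⟨B, hB0, hB⟩ := hf.exists_nonneg
  obtain ⟨C, hC⟩ := hg
  refine ⟨B * C, fun t z h => ?_⟩
  rw [abs_mul]
  exact mul_le_mul (hB t z h) (hC t z h) (abs_nonneg _) hB0

theorem sum {ι : Type*} (u : Finset ι) {f : ι → ℝ → State n p → ℝ}
    (hf : ∀ i ∈ u, UnifBdd P (f i)) : UnifBdd P fun t z => ∑ i ∈ u, f i t z := by
  classical
  induction u using Finset.induction_on with
  | empty => simpa using const 0
  | insert i u hi ih =>
    simp only [Finset.sum_insert hi]
    exact (hf i (Finset.mem_insert_self i u)).add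
      (ih fun k hk => hf k (Finset.mem_insert_of_mem hk))

theorem dotProduct {m : ℕ} {f g : ℝ → State n p → Vec m}
    (hf : ∀ i, UnifBdd P fun t z => f t z i) (hg : ∀ i, UnifBdd P fun t z => g t z i) :
    UnifBdd P fun t z => f t z ⬝ᵥ g t z :=
  sum Finset.univ fun i _ => (hf i).mul (hg i)

theorem vnorm {m : ℕ} {f : ℝ → State n p → Vec m} (hf : ∀ i, UnifBdd P fun t z => f t z i) :
    UnifBdd P fun t z => HSwap.vnorm (f t z) := by
  choose B hB using hf
  obtain ⟨C, hC⟩ := Finite.exists_le B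
  refine ⟨√(m * C ^ 2), fun t z h => ?_⟩
  rw [abs_of_nonneg (vnorm_nonneg _)]
  exact vnorm_le_of_abs_le fun i => (hB i t z h).trans (hC i)

theorem entry {f : ℝ → State n p → Vec n} (hf : ∀ i, UnifBdd P fun t z => f t z i) (k : ℕ) :
    UnifBdd P fun t z => HSwap.entry (f t z) k := by
  unfold HSwap.entry
  split_ifs
  exacts [hf _, const 0]

theorem reference (hr : IsReference n r) (hP : ∀ t z, P t z → 0 ≤ t) {k : ℕ} (hk : k ≤ n) :
    UnifBdd P fun t _ => r k t := by
  obtain ⟨B, hB⟩ := hr.bounded k hk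
  exact ⟨B, fun t z h => hB t (hP t z h)⟩

theorem comp {g : Pt n p → ℝ} (hg : Continuous g) {q : ℝ → State n p → Pt n p}
    (h₁ : ∀ i, UnifBdd P fun t z => (q t z).1 i) (h₂ : ∀ i, UnifBdd P fun t z => (q t z).2.1 i)
    (h₃ : ∀ j, UnifBdd P fun t z => (q t z).2.2 j) : UnifBdd P fun t z => g (q t z) := by
  obtain ⟨B₁, hB₁⟩ := vnorm h₁
  obtain ⟨B₂, hB₂⟩ := vnorm h₂
  obtain ⟨B₃, hB₃⟩ := vnorm h₃
  obtain ⟨C, hC⟩ :=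
    (isCompact_closedBall (0 : Pt n p) (max B₁ (max B₂ B₃))).exists_bound_of_continuousOn
      hg.continuousOn
  refine ⟨C, fun t z h => hC _ ?_⟩
  have hsup : ∀ {m : ℕ} (v : Vec m), ‖v‖ ≤ |HSwap.vnorm v| := fun v =>
    (norm_le_vnorm v).trans (le_abs_self _)
  rw [mem_closedBall_zero_iff, norm_prod_le_iff, norm_prod_le_iff]
  exact ⟨(hsup _).trans ((hB₁ t z h).trans (le_max_left _ _)),
    (hsup _).trans ((hB₂ t z h).trans ((le_max_left _ _).trans (le_max_right _ _))),
    (hsup _).trans ((hB₃ t z h).trans ((le_max_right _ _).trans (le_max_right _ _)))⟩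

end UnifBdd

end

/-! ### Uniform bounds for all closed-loop signals -/

section

variable {n p : ℕ} {d : Design n p} {φ : Fin n → Vec n → Vec p} {θ : Vec p} {r : ℕ → ℝ → ℝ}
  {R : ℝ}

/-! ### Initial and reachable states -/

/-- The possible initial times and states. -/
def Initial (R : ℝ) (t : ℝ) (z : State n p) : Prop := 0 ≤ t ∧ z.BoundedBy R

/-- The times and states on trajectories with initial state bounded by `R`. -/
def Reachable (d : Design n p) (φ : Fin n → Vec n → Vec p) (θ : Vec p) (r : ℕ → ℝ → ℝ) (R : ℝ)
    (t : ℝ) (z : State n p) : Prop :=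
  ∃ t₀ J y, IsTrajectory d φ θ r R t₀ J y ∧ t ∈ J ∧ y t = z

theorem Reachable.time_nonneg {t : ℝ} {z : State n p} (h : Reachable d φ θ r R t z) : 0 ≤ t := by
  obtain ⟨t₀, J, y, hy, ht, -⟩ := h
  exact hy.time_nonneg ht

theorem IsTrajectory.reachable {t₀ : ℝ} {J : Set ℝ} {z : ℝ → State n p}
    (h : IsTrajectory d φ θ r R t₀ J z) {t : ℝ} (ht : t ∈ J) : Reachable d φ θ r R t (z t) :=
  ⟨t₀, J, z, h, ht, rfl⟩

theorem abs_entry_le_sqrt_frobSq (M : Matrix (Fin p) (Fin n) ℝ) (j : Fin p) (i : Fin n) :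
    |M j i| ≤ √(frobSq M) := by
  refine Real.abs_le_sqrt ?_
  refine le_trans ?_ (Finset.single_le_sum (f := fun j => ∑ i, M j i ^ 2)
    (fun _ _ => Finset.sum_nonneg fun _ _ => sq_nonneg _) (Finset.mem_univ j))
  exact Finset.single_le_sum (f := fun i => M j i ^ 2) (fun _ _ => sq_nonneg _)
    (Finset.mem_univ i)

theorem frobSq_nonneg (M : Matrix (Fin p) (Fin n) ℝ) : 0 ≤ frobSq M :=
  Finset.sum_nonneg fun _ _ => Finset.sum_nonneg fun _ _ => sq_nonneg _

namespace Initial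

theorem unifBdd_x (i : Fin n) : UnifBdd (Initial R) fun _ (z : State n p) => z.x i :=
  ⟨R, fun _ z h => (abs_le_vnorm z.x i).trans h.2.1⟩

theorem unifBdd_θhat (j : Fin p) : UnifBdd (Initial R) fun _ (z : State n p) => z.θhat j :=
  ⟨R, fun _ z h => (abs_le_vnorm z.θhat j).trans h.2.2.1⟩

theorem unifBdd_Ω (j : Fin p) (i : Fin n) :
    UnifBdd (Initial R) fun _ (z : State n p) => z.Ω j i :=
  ⟨R, fun _ z h => (abs_entry_le_sqrt_frobSq z.Ω j i).trans h.2.2.2.1⟩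

theorem unifBdd_Ω₀ (i : Fin n) : UnifBdd (Initial R) fun _ (z : State n p) => z.Ω₀ i :=
  ⟨R, fun _ z h => (abs_le_vnorm z.Ω₀ i).trans h.2.2.2.2⟩

theorem unifBdd_pt (hr : IsReference n r) {g : Pt n p → ℝ} (hg : Continuous g) :
    UnifBdd (Initial R) fun t (z : State n p) => g (pt r t z) :=
  UnifBdd.comp hg unifBdd_x (fun i => UnifBdd.reference hr (fun _ _ h => h.1) i.isLt.le)
    unifBdd_θhat

theorem unifBdd_hAt (hφ : ∀ i, ContDiff ℝ ∞ (φ i)) (hr : IsReference n r) (i : Fin n) :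
    UnifBdd (Initial R) fun t (z : State n p) => hAt d φ r t z i :=
  unifBdd_pt hr ((continuous_apply i).comp (contDiff_hErr d hφ).continuous)

theorem unifBdd_epsTilde (hφ : ∀ i, ContDiff ℝ ∞ (φ i)) (hr : IsReference n r) (i : Fin n) :
    UnifBdd (Initial R) fun t (z : State n p) => epsTilde d φ θ r t z i :=
  ((unifBdd_hAt hφ hr i).add (unifBdd_Ω₀ i)).sub
    (UnifBdd.dotProduct (g := fun _ _ => θ) (fun j => unifBdd_Ω j i) fun j => UnifBdd.const (θ j))

end Initial

/-! ### Cascades along trajectories -/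

theorem exists_gain_bounds (hd : d.Admissible) (φ : Fin n → Vec n → Vec p) :
    ∃ c > 0, ∃ μ, 0 ≤ μ ∧ ∀ q i, c ≤ s d φ q i ∧ vnorm (w d φ q i) ≤ s d φ q i * μ ∧
      vnorm (dTheta (alpha d φ i.val) q) ≤ s d φ q i * μ := by
  obtain ⟨c, hc, hc'⟩ := exists_pos_le hd.c_pos
  obtain ⟨k, hk, hk'⟩ := exists_pos_le hd.κ_pos
  obtain ⟨g, hg, hg'⟩ := exists_pos_le hd.g_pos
  refine ⟨c, hc, max (1 / √(c * k) / 2) (1 / √(c * g) / 2), le_max_of_le_left (by positivity),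
    fun q i => ?_⟩
  have hs : c ≤ s d φ q i := (hc' i).trans (c_le_s hd φ q i)
  have hs0 : 0 ≤ s d φ q i := hc.le.trans hs
  exact ⟨hs, (vnorm_w_le hd φ q i hc hk (hc' i) (hk' i)).trans
      (mul_le_mul_of_nonneg_left (le_max_left _ _) hs0),
    (vnorm_dTheta_le hd φ q i hc hg (hc' i) (hg' i)).trans
      (mul_le_mul_of_nonneg_left (le_max_right _ _) hs0)⟩

section Cascade

variable {c M : ℝ} {ξ e : ℝ → State n p → Vec n}

/-- The constant K depends only on a bound for the initial values, hence is common to all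
trajectories starting in the ball of radius R, at any time and on any horizon. -/
theorem exists_decay_of_cascade (hr : IsReference n r) (hc : 0 < c)
    (hcs : ∀ q i, c ≤ s d φ q i) (hM : 0 ≤ M) (h0 : ∀ i, UnifBdd (Initial R) fun t z => ξ t z i)
    (hcont : ∀ t₀ J z, IsTrajectory d φ θ r R t₀ J z → ∀ i,
      ContinuousOn (fun t => ξ t (z t) i) J)
    (hder : ∀ z t, SolvesAt d φ θ r z t → ∀ i, HasDerivAt (fun t => ξ t (z t) i)
      (-s d φ (pt r t (z t)) i * ξ t (z t) i + entry (ξ t (z t)) (i.val + 1) + e t (z t) i) t)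
    (he : ∀ t z, Reachable d φ θ r R t z → ∀ i, |e t z i| ≤ s d φ (pt r t z) i * M) :
    ∃ K, 0 ≤ K ∧ ∀ t₀ J z, IsTrajectory d φ θ r R t₀ J z → ∀ t ∈ J, ∀ i,
      |ξ t (z t) i| ≤ K * Real.exp (-(c / 2) * (t - t₀)) + M * cascadeGain c n := by
  choose B hB using h0
  obtain ⟨C, hC⟩ := Finite.exists_le B
  refine ⟨(∑ k ∈ Finset.range n, (2 / c) ^ k) * |C|, by positivity, fun t₀ J z hz t ht i => ?_⟩
  have hsub := hz.horizon.Icc_subset ht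
  obtain ⟨D, hD, hsolve⟩ := hz.exists_solvesAt hr ht
  refine cascade_abs_le (S := fun t => s d φ (pt r t (z t))) (ξ := fun t => ξ t (z t))
    (e := fun t => e t (z t)) hc hM hD (fun i => (hcont t₀ J z hz i).mono hsub)
    (fun i => ?_) (fun u hu i => ⟨hcs _ _, he u _ (hz.reachable (hsub ⟨hu.1.1.le, hu.1.2.le⟩)) i,
      hder z u (hsolve u hu) i⟩) t ⟨hz.start_le ht, le_rfl⟩ i
  exact (hB i t₀ _ ⟨hz.nonneg, hz.init⟩).trans ((hC i).trans (le_abs_self C))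

theorem unifBdd_of_cascade (hr : IsReference n r) (hc : 0 < c)
    (hcs : ∀ q i, c ≤ s d φ q i) (hM : 0 ≤ M) (h0 : ∀ i, UnifBdd (Initial R) fun t z => ξ t z i)
    (hcont : ∀ t₀ J z, IsTrajectory d φ θ r R t₀ J z → ∀ i,
      ContinuousOn (fun t => ξ t (z t) i) J)
    (hder : ∀ z t, SolvesAt d φ θ r z t → ∀ i, HasDerivAt (fun t => ξ t (z t) i)
      (-s d φ (pt r t (z t)) i * ξ t (z t) i + entry (ξ t (z t)) (i.val + 1) + e t (z t) i) t)
    (he : ∀ t z, Reachable d φ θ r R t z → ∀ i, |e t z i| ≤ s d φ (pt r t z) i * M) (i : Fin n) :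
    UnifBdd (Reachable d φ θ r R) fun t z => ξ t z i := by
  obtain ⟨K, hK, h⟩ := exists_decay_of_cascade hr hc hcs hM h0 hcont hder he
  refine ⟨K + M * cascadeGain c n, ?_⟩
  rintro t _ ⟨t₀, J, z, hz, ht, rfl⟩
  have h1 : Real.exp (-(c / 2) * (t - t₀)) ≤ 1 := by
    rw [Real.exp_le_one_iff]
    have := mul_nonneg (half_pos hc).le (sub_nonneg.2 (hz.start_le ht))
    linarith
  have h2 := mul_le_mul_of_nonneg_left h1 hK
  linarith [h t₀ J z hz t ht i]

end Cascade

/-! ### Dissipation of the parameter error -/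

/-- Cauchy-Schwarz for the form Γ⁻¹, applied to v and u = Γ e_j: v_j is their product and Γ_jj the
square of u. It turns a bound on the Lyapunov function into coordinate bounds without eigenvalues.
-/
theorem sq_le_of_posDef {Γ : Matrix (Fin p) (Fin p) ℝ} (hΓ : Γ.PosDef) (v : Vec p) (j : Fin p) :
    v j ^ 2 ≤ Γ j j * (v ⬝ᵥ Γ⁻¹ *ᵥ v) := by
  have hjj : 0 < Γ j j := hΓ.diag_pos
  set u : Vec p := Γ *ᵥ Pi.single j 1 with hu
  have hΓu : Γ⁻¹ *ᵥ u = Pi.single j 1 := by rw [hu, Matrix.mulVec_mulVec, inv_mul_of_posDef hΓ,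
    Matrix.one_mulVec]
  have huv : u ⬝ᵥ Γ⁻¹ *ᵥ v = v j := by
    rw [dotProduct_comm, ← transpose_inv_of_posDef hΓ, Matrix.mulVec_transpose,
      ← Matrix.dotProduct_mulVec, hΓu]
    simp
  have huj : u j = Γ j j := by simp [hu]
  have h := hΓ.inv.posSemidef.dotProduct_mulVec_nonneg (v - (v j / Γ j j) • u)
  have hexp : star (v - (v j / Γ j j) • u) ⬝ᵥ Γ⁻¹ *ᵥ (v - (v j / Γ j j) • u) =
      v ⬝ᵥ Γ⁻¹ *ᵥ v - v j ^ 2 / Γ j j := by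
    rw [star_trivial, Matrix.mulVec_sub, Matrix.mulVec_smul, hΓu, sub_dotProduct, dotProduct_sub,
      dotProduct_sub, smul_dotProduct, smul_dotProduct, huv, dotProduct_smul, dotProduct_smul,
      dotProduct_single, dotProduct_single, huj]
    simp only [smul_eq_mul, mul_one]
    field_simp
    ring
  rw [hexp, sub_nonneg, div_le_iff₀ hjj] at h
  linarith

theorem one_le_normalization (hd : d.Admissible) (M : Matrix (Fin p) (Fin n) ℝ) :
    1 ≤ 1 + d.ν * frobSq M :=
  le_add_of_nonneg_right (mul_nonneg hd.ν_nonneg (frobSq_nonneg M))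

/-- With b = Ωᵀθ̃ = ε - ε̃ one has -2 b·ε = |ε̃|² - |ε|² - |b|². The square |ε̃|² is at most
nK²e^{-c(t-t₀)}, exactly the rate at which the added exponential term decreases, and the normalizing
factor is at most 1. -/
theorem SolvesAt.exists_dissipation (hd : d.Admissible) {z : ℝ → State n p} {t₀ t c K : ℝ}
    (hc : 0 < c) (h : SolvesAt d φ θ r z t)
    (hε : ∀ i, |epsTilde d φ θ r t (z t) i| ≤ K * Real.exp (-(c / 2) * (t - t₀))) :
    ∃ V', V' ≤ -((1 + d.ν * frobSq (z t).Ω)⁻¹ * ∑ i, eps d φ r t (z t) i ^ 2) ∧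
      HasDerivAt (fun t => (θ - (z t).θhat) ⬝ᵥ (d.Γ⁻¹ *ᵥ (θ - (z t).θhat))
        + n * K ^ 2 / c * Real.exp (-c * (t - t₀))) V' t := by
  have hexp : HasDerivAt (fun t => Real.exp (-c * (t - t₀)))
      (Real.exp (-c * (t - t₀)) * -c) t := by
    have h1 : HasDerivAt (fun t => -c * (t - t₀)) (-c) t := by
      simpa using ((hasDerivAt_id t).sub_const t₀).const_mul (-c)
    exact h1.exp
  refine ⟨_, ?_, (h.hasDerivAt_lyapunov hd).add (hexp.const_mul (n * K ^ 2 / c))⟩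
  set m := (1 + d.ν * frobSq (z t).Ω)⁻¹ with hm
  have hm1 : m ≤ 1 := inv_le_one_of_one_le₀ (one_le_normalization hd _)
  have hm0 : 0 ≤ m := inv_nonneg.2 (zero_le_one.trans (one_le_normalization hd _))
  have hsum : ∑ i, epsTilde d φ θ r t (z t) i ^ 2 ≤ n * K ^ 2 * Real.exp (-c * (t - t₀)) := by
    calc ∑ i, epsTilde d φ θ r t (z t) i ^ 2
        ≤ ∑ _i : Fin n, (K * Real.exp (-(c / 2) * (t - t₀))) ^ 2 :=
          Finset.sum_le_sum fun i _ => sq_le_sq.2 ((hε i).trans (le_abs_self _))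
      _ = n * K ^ 2 * Real.exp (-c * (t - t₀)) := by
          rw [Finset.sum_const, Finset.card_univ, Fintype.card_fin, nsmul_eq_mul, mul_pow,
            ← Real.exp_nat_mul]
          push_cast
          ring_nf
  have hdot : -2 * (((z t).Ωᵀ *ᵥ (θ - (z t).θhat)) ⬝ᵥ eps d φ r t (z t)) ≤
      ∑ i, epsTilde d φ θ r t (z t) i ^ 2 - ∑ i, eps d φ r t (z t) i ^ 2 := by
    rw [← Finset.sum_sub_distrib, dotProduct, Finset.mul_sum]
    refine Finset.sum_le_sum fun i _ => ?_
    have := congrFun (eps_eq_epsTilde_add d φ θ r t (z t)) i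
    rw [Pi.add_apply] at this
    rw [this]
    nlinarith [sq_nonneg (((z t).Ωᵀ *ᵥ (θ - (z t).θhat)) i)]
  have h0 : 0 ≤ ∑ i, epsTilde d φ θ r t (z t) i ^ 2 := Finset.sum_nonneg fun _ _ => sq_nonneg _
  have h1 := mul_le_mul_of_nonneg_left hdot hm0
  have h2 := mul_le_of_le_one_left h0 hm1
  have h3 : (n * K ^ 2 / c) * (Real.exp (-c * (t - t₀)) * -c) =
      -(n * K ^ 2 * Real.exp (-c * (t - t₀))) := by field_simp
  rw [h3]
  linarith

/-! ### Boundedness of the closed-loop signals -/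

section Bounded

variable (hφ : ∀ i, ContDiff ℝ ∞ (φ i)) (hsf : IsStrictFeedback φ) (hr : IsReference n r)
  (hd : d.Admissible)
include hφ hsf hr hd

/-- An undisturbed cascade: M = 0 leaves only the decaying term. -/
theorem exists_epsTilde_decay (θ : Vec p) (R : ℝ) :
    ∃ c > 0, ∃ K, ∀ t₀ J z, IsTrajectory d φ θ r R t₀ J z → ∀ t ∈ J, ∀ i,
      |epsTilde d φ θ r t (z t) i| ≤ K * Real.exp (-(c / 2) * (t - t₀)) := by
  obtain ⟨c, hc, μ, -, hμ⟩ := exists_gain_bounds hd φ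
  obtain ⟨K, -, h⟩ := exists_decay_of_cascade (R := R) (M := 0) (e := fun _ _ => 0)
    (ξ := epsTilde d φ θ r) hr hc (fun q i => (hμ q i).1) le_rfl
    (Initial.unifBdd_epsTilde hφ hr) (fun t₀ J z hz => hz.continuousOn_epsTilde hφ hr)
    (fun z t h i => by simpa using h.hasDerivAt_epsTilde hφ hsf i) (by simp)
  exact ⟨c, hc, K, by simpa using h⟩

theorem unifBdd_epsTilde (i : Fin n) :
    UnifBdd (Reachable d φ θ r R) fun t z => epsTilde d φ θ r t z i := by
  obtain ⟨c, hc, K, h⟩ := exists_epsTilde_decay hφ hsf hr hd θ R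
  refine ⟨|K|, ?_⟩
  rintro t _ ⟨t₀, J, z, hz, ht, rfl⟩
  refine (h t₀ J z hz t ht i).trans ((mul_le_mul_of_nonneg_right (le_abs_self K)
    (Real.exp_pos _).le).trans (mul_le_of_le_one_right (abs_nonneg K) ?_))
  rw [Real.exp_le_one_iff]
  have := mul_nonneg (half_pos hc).le (sub_nonneg.2 (hz.start_le ht))
  linarith

/-- The Lyapunov function with its exponential correction never exceeds its initial value, which is
uniformly bounded over the initial ball. -/
theorem unifBdd_thetaTilde (j : Fin p) :
    UnifBdd (Reachable d φ θ r R) fun _ z => (θ - z.θhat) j := by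
  obtain ⟨c, hc, K, hK⟩ := exists_epsTilde_decay hφ hsf hr hd θ R
  have hVcont : Continuous fun q : Pt n p => (θ - q.2.2) ⬝ᵥ (d.Γ⁻¹ *ᵥ (θ - q.2.2)) := by
    fun_prop
  obtain ⟨B, hB⟩ := Initial.unifBdd_pt (R := R) hr hVcont
  refine ⟨√(d.Γ j j * (B + n * K ^ 2 / c)), ?_⟩
  rintro t _ ⟨t₀, J, z, hz, ht, rfl⟩
  obtain ⟨D, hD, hsolve⟩ := hz.exists_solvesAt hr ht
  have hsub := hz.horizon.Icc_subset ht
  have hmono := le_of_deriv_nonpos_off_finite hD (hz.start_le ht)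
    (f := fun t => (θ - (z t).θhat) ⬝ᵥ (d.Γ⁻¹ *ᵥ (θ - (z t).θhat))
        + n * K ^ 2 / c * Real.exp (-c * (t - t₀)))
    ((hz.continuousOn_lyapunov.mono hsub).add (by fun_prop)) (by
      intro u hu
      obtain ⟨V', hV', hder⟩ := (hsolve u hu).exists_dissipation hd hc
        (hK t₀ J z hz u (hsub ⟨hu.1.1.le, hu.1.2.le⟩))
      refine ⟨V', hV'.trans (neg_nonpos.2 (mul_nonneg (inv_nonneg.2 (zero_le_one.trans
        (one_le_normalization hd _))) (Finset.sum_nonneg fun _ _ => sq_nonneg _))), hder⟩)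
  refine Real.abs_le_sqrt ((sq_le_of_posDef hd.Γ_pos _ j).trans ?_)
  refine mul_le_mul_of_nonneg_left ?_ hd.Γ_pos.diag_pos.le
  have h0 := (abs_le.1 (hB t₀ (z t₀) ⟨hz.nonneg, hz.init⟩)).2
  have hexp : 0 ≤ n * K ^ 2 / c * Real.exp (-c * (t - t₀)) := by positivity
  simp only [sub_self, mul_zero, Real.exp_zero, mul_one] at hmono
  simp only [pt] at h0
  linarith

theorem unifBdd_θhat (j : Fin p) : UnifBdd (Reachable d φ θ r R) fun _ z => z.θhat j := by
  simpa using (UnifBdd.const (θ j)).sub (unifBdd_thetaTilde (θ := θ) (R := R) hφ hsf hr hd j)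

omit hφ hsf in
-- Each row of Ω is a cascade driven by components of w_i, which s_i dominates although w_i itself
-- is not yet known to be bounded.
theorem unifBdd_Ω (j : Fin p) (i : Fin n) :
    UnifBdd (Reachable d φ θ r R) fun _ z => z.Ω j i := by
  obtain ⟨c, hc, μ, hμ0, hμ⟩ := exists_gain_bounds hd φ
  exact unifBdd_of_cascade (ξ := fun _ z => z.Ω j) (e := fun t z i => w d φ (pt r t z) i j) hr hc
    (fun q i => (hμ q i).1) hμ0 (Initial.unifBdd_Ω j) (fun t₀ J z hz => hz.continuousOn_Ω j)
    (fun z t h => h.hasDerivAt_Ω j)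
    (fun t z _ i => (abs_le_vnorm _ j).trans (hμ _ i).2.1) i

theorem unifBdd_eps (i : Fin n) : UnifBdd (Reachable d φ θ r R) fun t z => eps d φ r t z i := by
  simp only [eps_eq_epsTilde_add d φ θ]
  exact (unifBdd_epsTilde hφ hsf hr hd i).add (UnifBdd.dotProduct (fun j => unifBdd_Ω hr hd j i)
    (unifBdd_thetaTilde hφ hsf hr hd))

omit hφ hsf hr in
theorem abs_inv_normalization_le (M : Matrix (Fin p) (Fin n) ℝ) :
    |(1 + d.ν * frobSq M)⁻¹| ≤ 1 := by
  rw [abs_of_nonneg (inv_nonneg.2 (zero_le_one.trans (one_le_normalization hd _)))]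
  exact inv_le_one_of_one_le₀ (one_le_normalization hd _)

theorem unifBdd_updateLaw (j : Fin p) :
    UnifBdd (Reachable d φ θ r R) fun t z => updateLaw d φ r t z j := by
  refine UnifBdd.mul (f := fun _ z => (1 + d.ν * frobSq z.Ω)⁻¹)
    ⟨1, fun t z _ => abs_inv_normalization_le hd z.Ω⟩ ?_
  exact UnifBdd.dotProduct (f := fun _ _ => d.Γ j) (fun k => UnifBdd.const _) fun k =>
    UnifBdd.dotProduct (unifBdd_Ω hr hd k) (unifBdd_eps hφ hsf hr hd)

/-- With θ̃ and θ̂' bounded, both disturbance terms are dominated by the gains. -/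
theorem unifBdd_hAt (i : Fin n) : UnifBdd (Reachable d φ θ r R) fun t z => hAt d φ r t z i := by
  obtain ⟨c, hc, μ, hμ0, hμ⟩ := exists_gain_bounds hd φ
  obtain ⟨B, hB0, hB⟩ := (UnifBdd.vnorm
    (unifBdd_thetaTilde (θ := θ) (R := R) hφ hsf hr hd)).exists_nonneg
  obtain ⟨C, hC0, hC⟩ := (UnifBdd.vnorm
    (unifBdd_updateLaw (θ := θ) (R := R) hφ hsf hr hd)).exists_nonneg
  refine unifBdd_of_cascade (M := μ * B + μ * C) (e := fun t z i =>
    w d φ (pt r t z) i ⬝ᵥ (θ - z.θhat) - dTheta (alpha d φ i.val) (pt r t z) ⬝ᵥ updateLaw d φ r t z)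
    hr hc (fun q i => (hμ q i).1) (by positivity)
    (Initial.unifBdd_hAt hφ hr) (fun t₀ J z hz => hz.continuousOn_hAt hφ hr)
    (fun z t h i => (h.hasDerivAt_hAt hφ hsf i).congr_deriv (add_sub_assoc _ _ _)) ?_ i
  intro t z hz i
  obtain ⟨h1, h2, h3⟩ := hμ (pt r t z) i
  have hs : 0 ≤ s d φ (pt r t z) i := hc.le.trans h1
  have h4 := (dotProduct_le_vnorm (w d φ (pt r t z) i) (θ - z.θhat)).trans
    (mul_le_mul h2 ((le_abs_self _).trans (hB t z hz)) (vnorm_nonneg _) (mul_nonneg hs hμ0))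
  have h5 := (dotProduct_le_vnorm (dTheta (alpha d φ i.val) (pt r t z)) (updateLaw d φ r t z)).trans
    (mul_le_mul h3 ((le_abs_self _).trans (hC t z hz)) (vnorm_nonneg _) (mul_nonneg hs hμ0))
  calc _ ≤ _ := abs_sub _ _
    _ ≤ _ := add_le_add h4 h5
    _ = _ := by ring

omit hφ hsf hd in
theorem unifBdd_reference {k : ℕ} (hk : k ≤ n) :
    UnifBdd (Reachable d φ θ r R) fun t _ => r k t :=
  UnifBdd.reference hr (fun _ _ h => h.time_nonneg) hk

/-- Solve h_i = x_i - α_{i-1} - r^{(i-1)} for x_i: α_{i-1} is a continuous function of bounded data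
once the earlier coordinates are bounded. Evaluating it at the cut point hides the later ones. -/
theorem unifBdd_x (i : Fin n) : UnifBdd (Reachable d φ θ r R) fun _ z => z.x i := by
  obtain ⟨k, hk⟩ := i
  induction k using Nat.strong_induction_on with
  | _ k ih =>
    have hcutv : ∀ {f : ℝ → State n p → Vec n},
        (∀ i : Fin n, i.val < k → UnifBdd (Reachable d φ θ r R) fun t z => f t z i) → ∀ i,
        UnifBdd (Reachable d φ θ r R) fun t z => cutVec n k (f t z) i := by
      intro f hf i
      simp only [cutVec_apply]
      split_ifs with hi
      exacts [hf i hi, UnifBdd.const 0]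
    have hα : UnifBdd (Reachable d φ θ r R) fun t z => alpha d φ k (cut n p k (pt r t z)) :=
      UnifBdd.comp (contDiff_alpha d hφ k).continuous
        (hcutv fun i hi => ih i.val hi i.isLt)
        (hcutv fun i _ => unifBdd_reference hr i.isLt.le) (unifBdd_θhat hφ hsf hr hd)
    have := ((unifBdd_hAt (θ := θ) (R := R) hφ hsf hr hd ⟨k, hk⟩).add hα).add
      (unifBdd_reference hr hk.le)
    simp only [← alpha_cut d hφ hsf k] at this
    convert this using 3
    simp only [hAt, hErr, pt]
    ring

theorem unifBdd_pt {g : Pt n p → ℝ} (hg : Continuous g) :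
    UnifBdd (Reachable d φ θ r R) fun t z => g (pt r t z) :=
  UnifBdd.comp hg (unifBdd_x hφ hsf hr hd) (fun i => unifBdd_reference hr i.isLt.le)
    (unifBdd_θhat hφ hsf hr hd)

theorem unifBdd_chi (i : Fin n) : UnifBdd (Reachable d φ θ r R) fun _ z => chi z i := by
  have := (unifBdd_eps (θ := θ) (R := R) hφ hsf hr hd i).sub (unifBdd_hAt hφ hsf hr hd i)
  simpa [eps_eq_hAt_add_chi] using this

theorem unifBdd_Ω₀ (i : Fin n) : UnifBdd (Reachable d φ θ r R) fun _ z => z.Ω₀ i := by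
  have := (unifBdd_chi (θ := θ) (R := R) hφ hsf hr hd i).add
    (UnifBdd.dotProduct (fun j => unifBdd_Ω hr hd j i) (unifBdd_θhat hφ hsf hr hd))
  refine (funext₂ fun t z => ?_ : (fun (_ : ℝ) (z : State n p) => z.Ω₀ i) = _) ▸ this
  exact (sub_add_cancel _ _).symm

theorem unifBdd_control : UnifBdd (Reachable d φ θ r R) fun t z => control d φ r t z :=
  (unifBdd_pt hφ hsf hr hd (contDiff_alpha d hφ n).continuous).add (unifBdd_reference hr le_rfl)

theorem exists_signals_bound (θ : Vec p) (R : ℝ) : ∃ B, ∀ t z, Reachable d φ θ r R t z →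
    SignalsBoundedBy d φ θ r t z B := by
  have hfrob : UnifBdd (Reachable d φ θ r R) fun _ z => frobSq z.Ω :=
    UnifBdd.sum Finset.univ fun j _ => UnifBdd.sum Finset.univ fun i _ => by
      simpa only [sq] using (unifBdd_Ω hr hd j i).mul (unifBdd_Ω hr hd j i)
  obtain ⟨B₁, p₁, h₁⟩ := (UnifBdd.vnorm (unifBdd_x (θ := θ) (R := R) hφ hsf hr hd)).exists_nonneg
  obtain ⟨B₂, p₂, h₂⟩ := (UnifBdd.vnorm (unifBdd_θhat (θ := θ) (R := R) hφ hsf hr hd)).exists_nonneg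
  obtain ⟨B₃, p₃, h₃⟩ := hfrob.exists_nonneg
  obtain ⟨B₄, p₄, h₄⟩ := (UnifBdd.vnorm (unifBdd_Ω₀ (θ := θ) (R := R) hφ hsf hr hd)).exists_nonneg
  obtain ⟨B₅, p₅, h₅⟩ := (UnifBdd.vnorm (unifBdd_hAt (θ := θ) (R := R) hφ hsf hr hd)).exists_nonneg
  obtain ⟨B₆, p₆, h₆⟩ :=
    (UnifBdd.vnorm (unifBdd_thetaTilde (θ := θ) (R := R) hφ hsf hr hd)).exists_nonneg
  obtain ⟨B₇, p₇, h₇⟩ := (UnifBdd.vnorm (unifBdd_eps (θ := θ) (R := R) hφ hsf hr hd)).exists_nonneg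
  obtain ⟨B₈, p₈, h₈⟩ := (unifBdd_control (θ := θ) (R := R) hφ hsf hr hd).exists_nonneg
  obtain ⟨B₉, p₉, h₉⟩ :=
    (UnifBdd.vnorm (unifBdd_updateLaw (θ := θ) (R := R) hφ hsf hr hd)).exists_nonneg
  have p₃' := Real.sqrt_nonneg B₃
  refine ⟨B₁ + B₂ + √B₃ + B₄ + B₅ + B₆ + B₇ + B₈ + B₉, fun t z hz =>
    ⟨⟨?_, ?_, ?_, ?_⟩, ?_, ?_, ?_, ?_, ?_⟩⟩
  · linarith [(le_abs_self _).trans (h₁ t z hz)]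
  · linarith [(le_abs_self _).trans (h₂ t z hz)]
  · linarith [Real.sqrt_le_sqrt ((le_abs_self _).trans (h₃ t z hz))]
  · linarith [(le_abs_self _).trans (h₄ t z hz)]
  · linarith [(le_abs_self _).trans (h₅ t z hz)]
  · linarith [(le_abs_self _).trans (h₆ t z hz)]
  · linarith [(le_abs_self _).trans (h₇ t z hz)]
  · linarith [h₈ t z hz]
  · linarith [(le_abs_self _).trans (h₉ t z hz)]

end Bounded

end

/-! ### Convergence of the error signals -/

section

variable {n p : ℕ} {d : Design n p} {φ : Fin n → Vec n → Vec p} {θ : Vec p} {r : ℕ → ℝ → ℝ}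
  {R : ℝ}

/-! ### Asymptotic tracking -/

theorem tendsto_mul_zero_of_bdd {f g : ℝ → ℝ} {t₀ B : ℝ} (hg : ∀ t, t₀ ≤ t → |g t| ≤ B)
    (hf : Tendsto f atTop (𝓝 0)) : Tendsto (fun t => g t * f t) atTop (𝓝 0) := by
  have h1 : Tendsto (fun t => B * |f t|) atTop (𝓝 0) := by
    simpa using (hf.abs).const_mul B
  refine squeeze_zero_norm' ?_ h1
  filter_upwards [eventually_ge_atTop t₀] with t ht
  rw [Real.norm_eq_abs, abs_mul]
  exact mul_le_mul_of_nonneg_right (hg t ht) (abs_nonneg _)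

section Tracking

variable (hφ : ∀ i, ContDiff ℝ ∞ (φ i)) (hsf : IsStrictFeedback φ) (hr : IsReference n r)
  (hd : d.Admissible) {t₀ : ℝ} {z : ℝ → State n p}
  (hz : IsTrajectory d φ θ r R t₀ (Set.Ici t₀) z)
include hφ hsf hr hd hz

theorem IsTrajectory.tendsto_eps (i : Fin n) :
    Tendsto (fun t => eps d φ r t (z t) i) atTop (𝓝 0) := by
  obtain ⟨c, hc, K, hK⟩ := exists_epsTilde_decay hφ hsf hr hd θ R
  have hbh := unifBdd_hAt (θ := θ) (R := R) hφ hsf hr hd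
  have hbχ := unifBdd_chi (θ := θ) (R := R) hφ hsf hr hd
  have hbu := unifBdd_updateLaw (θ := θ) (R := R) hφ hsf hr hd
  have hbs : ∀ i, UnifBdd (Reachable d φ θ r R) fun t z => s d φ (pt r t z) i := fun i =>
    unifBdd_pt hφ hsf hr hd (contDiff_s d hφ i).continuous
  have hbw : ∀ i j, UnifBdd (Reachable d φ θ r R) fun t z => w d φ (pt r t z) i j := fun i j =>
    unifBdd_pt hφ hsf hr hd ((continuous_apply j).comp (contDiff_w d hφ i).continuous)
  have hbT : ∀ (i : Fin n) j, UnifBdd (Reachable d φ θ r R) fun t z =>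
      dTheta (alpha d φ i.val) (pt r t z) j := fun i j =>
    unifBdd_pt hφ hsf hr hd
      ((continuous_apply j).comp (contDiff_dTheta (contDiff_alpha d hφ i.val)).continuous)
  -- Bound for the derivative of ∑ ε_i², written as ∑ 2ε_i(h_i' + χ_i').
  obtain ⟨C, hC0, hC⟩ := UnifBdd.exists_nonneg <|
    UnifBdd.sum (P := Reachable d φ θ r R) Finset.univ fun i (_ : i ∈ Finset.univ) =>
      ((UnifBdd.const 2).mul (unifBdd_eps (θ := θ) (R := R) hφ hsf hr hd i)).mul
        ((((((hbs i).neg.mul (hbh i)).add (UnifBdd.entry hbh (i.val + 1))).add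
          (UnifBdd.dotProduct (hbw i) (unifBdd_thetaTilde hφ hsf hr hd))).sub
          (UnifBdd.dotProduct (hbT i) hbu)).add
        (((((hbs i).neg.mul (hbχ i)).add (UnifBdd.entry hbχ (i.val + 1))).add
          (UnifBdd.dotProduct (hbT i) hbu)).sub
          (UnifBdd.dotProduct (fun j => unifBdd_Ω hr hd j i) hbu)))
  -- A bound on |Ω|_F² keeps the normalizing factor away from zero, so the dissipation rate is
  -- uniform.
  obtain ⟨F, hF0, hF⟩ := UnifBdd.exists_nonneg <|
    UnifBdd.sum (P := Reachable d φ θ r R) Finset.univ fun j (_ : j ∈ Finset.univ) =>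
      UnifBdd.sum Finset.univ fun i (_ : i ∈ Finset.univ) =>
        (unifBdd_Ω hr hd j i).mul (unifBdd_Ω hr hd j i)
  have hm : 0 < 1 + d.ν * F := by
    have := mul_nonneg hd.ν_nonneg hF0
    linarith
  have hsq : Tendsto (fun t => ∑ i, eps d φ r t (z t) i ^ 2) atTop (𝓝 0) := by
    refine tendsto_zero_of_dissipation (t₀ := t₀) (k := (1 + d.ν * F)⁻¹) (K := C + 1)
      (U := fun t => (θ - (z t).θhat) ⬝ᵥ (d.Γ⁻¹ *ᵥ (θ - (z t).θhat))
        + n * K ^ 2 / c * Real.exp (-c * (t - t₀))) (inv_pos.2 hm) (by linarith)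
      (hz.continuousOn_lyapunov.add (by fun_prop))
      (continuousOn_finsetSum _ fun i _ => (hz.continuousOn_eps hφ hr i).pow 2) ?_
      (fun t _ => Finset.sum_nonneg fun _ _ => sq_nonneg _) ?_
    · intro t _
      have h1 := hd.Γ_pos.inv.posSemidef.dotProduct_mulVec_nonneg (θ - (z t).θhat)
      rw [star_trivial] at h1
      positivity
    · intro b hb
      obtain ⟨D, hD, hsolve⟩ := hz.exists_solvesAt hr hb
      refine ⟨D, hD, fun t ht => ⟨?_, ?_⟩⟩
      · have htJ : t ∈ Set.Ici t₀ := ht.1.1.le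
        obtain ⟨V', hV', hder⟩ := (hsolve t ht).exists_dissipation hd hc (hK t₀ _ z hz t htJ)
        refine ⟨V', hV'.trans ?_, hder⟩
        rw [neg_mul]
        refine neg_le_neg (mul_le_mul_of_nonneg_right ?_
          (Finset.sum_nonneg fun _ _ => sq_nonneg _))
        refine inv_anti₀ (zero_lt_one.trans_le (one_le_normalization hd _)) ?_
        have h1 := (le_abs_self _).trans (hF t (z t) (hz.reachable htJ))
        simp only [← sq] at h1
        have := mul_le_mul_of_nonneg_left h1 hd.ν_nonneg
        simp only [frobSq]
        linarith
      · refine ⟨_, (hC t (z t) (hz.reachable ht.1.1.le)).trans (by linarith), ?_⟩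
        refine HasDerivAt.fun_sum fun i _ => ?_
        have h1 := ((hsolve t ht).hasDerivAt_hAt hφ hsf i).add ((hsolve t ht).hasDerivAt_chi i)
        have h3 : HasDerivAt (fun t => eps d φ r t (z t) i) _ t :=
          h1.congr_of_eventuallyEq (Eventually.of_forall fun t =>
            congrFun (eps_eq_hAt_add_chi d φ r t (z t)) i)
        refine (h3.pow 2).congr_deriv ?_
        norm_num
        left
        rfl
  refine squeeze_zero_norm (fun t => ?_) (by simpa using hsq.sqrt)
  exact Real.abs_le_sqrt (Finset.single_le_sum (f := fun i => eps d φ r t (z t) i ^ 2)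
    (fun _ _ => sq_nonneg _) (Finset.mem_univ i))

theorem IsTrajectory.tendsto_updateLaw (j : Fin p) :
    Tendsto (fun t => updateLaw d φ r t (z t) j) atTop (𝓝 0) := by
  refine tendsto_mul_zero_of_bdd (B := 1) (t₀ := t₀)
    (g := fun t => (1 + d.ν * frobSq (z t).Ω)⁻¹)
    (f := fun t => (d.Γ *ᵥ ((z t).Ω *ᵥ eps d φ r t (z t))) j)
    (fun t _ => abs_inv_normalization_le hd _) ?_
  have hΩ : ∀ k, Tendsto (fun t => ((z t).Ω *ᵥ eps d φ r t (z t)) k) atTop (𝓝 0) := fun k => by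
    rw [← Finset.sum_const_zero (s := (Finset.univ : Finset (Fin n)))]
    refine tendsto_finsetSum _ fun i _ => ?_
    obtain ⟨B, hB⟩ := unifBdd_Ω (θ := θ) (R := R) hr hd k i
    exact tendsto_mul_zero_of_bdd (fun t ht => hB t (z t) (hz.reachable ht))
      (hz.tendsto_eps hφ hsf hr hd i)
  rw [← Finset.sum_const_zero (s := (Finset.univ : Finset (Fin p)))]
  exact tendsto_finsetSum _ fun k _ => by simpa using (hΩ k).const_mul (d.Γ j k)

/-- Restart the cascade at a late time T. From then on the disturbance is at most cδ ≤ s_i δ, so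
after the transient |χ_i| is bounded by about δ times the cascade gain. -/
theorem IsTrajectory.tendsto_chi (i : Fin n) : Tendsto (fun t => chi (z t) i) atTop (𝓝 0) := by
  obtain ⟨c, hc, μ, -, hμ⟩ := exists_gain_bounds hd φ
  set e : ℝ → Vec n := fun t i => dTheta (alpha d φ i.val) (pt r t (z t)) ⬝ᵥ updateLaw d φ r t (z t)
    - ((z t).Ωᵀ *ᵥ updateLaw d φ r t (z t)) i with he
  have hlim : ∀ i, Tendsto (fun t => e t i) atTop (𝓝 0) := fun i => by
    have h1 : Tendsto (fun t => dTheta (alpha d φ i.val) (pt r t (z t)) ⬝ᵥ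
        updateLaw d φ r t (z t)) atTop (𝓝 0) := by
      rw [← Finset.sum_const_zero (s := (Finset.univ : Finset (Fin p)))]
      refine tendsto_finsetSum _ fun j _ => ?_
      obtain ⟨B, hB⟩ := unifBdd_pt (θ := θ) (R := R) hφ hsf hr hd
        ((continuous_apply j).comp (contDiff_dTheta (contDiff_alpha d hφ i.val)).continuous)
      exact tendsto_mul_zero_of_bdd (fun t ht => hB t (z t) (hz.reachable ht))
        (hz.tendsto_updateLaw hφ hsf hr hd j)
    have h2 : Tendsto (fun t => ((z t).Ωᵀ *ᵥ updateLaw d φ r t (z t)) i) atTop (𝓝 0) := by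
      rw [← Finset.sum_const_zero (s := (Finset.univ : Finset (Fin p)))]
      refine tendsto_finsetSum _ fun j _ => ?_
      obtain ⟨B, hB⟩ := unifBdd_Ω (θ := θ) (R := R) hr hd j i
      exact tendsto_mul_zero_of_bdd (fun t ht => hB t (z t) (hz.reachable ht))
        (hz.tendsto_updateLaw hφ hsf hr hd j)
    simpa using h1.sub h2
  obtain ⟨B, hB⟩ : ∃ B, ∀ t, t₀ ≤ t → ∀ i, |chi (z t) i| ≤ B := by
    choose B hB using unifBdd_chi (θ := θ) (R := R) hφ hsf hr hd
    obtain ⟨C, hC⟩ := Finite.exists_le B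
    exact ⟨C, fun t ht i => (hB i t (z t) (hz.reachable ht)).trans (hC i)⟩
  have hG := cascadeGain_nonneg hc n
  rw [Metric.tendsto_atTop]
  intro η hη
  -- Makes the persistent part at most η/2; the added 1 avoids dividing by zero.
  set δ := η / (2 * (cascadeGain c n + 1)) with hδ
  have hδ0 : 0 < δ := by positivity
  have hsmall : ∀ᶠ t in atTop, ∀ i, |e t i| ≤ c * δ := by
    refine eventually_all.2 fun i => ?_
    have := (hlim i).abs.eventually_le_const (u := c * δ) (by simpa using mul_pos hc hδ0)
    exact this
  obtain ⟨T₁, hT₁⟩ := eventually_atTop.1 hsmall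
  set T := max T₁ t₀ with hT
  have hdecay : ∀ t, T ≤ t → |chi (z t) i| ≤
      (∑ k ∈ Finset.range n, (2 / c) ^ k) * B * Real.exp (-(c / 2) * (t - T))
        + δ * cascadeGain c n := by
    intro t ht
    obtain ⟨D, hD, hsolve⟩ := hz.exists_solvesAt hr (b := t) ((le_max_right _ _).trans ht)
    refine cascade_abs_le (S := fun t => s d φ (pt r t (z t))) (ξ := fun t => chi (z t))
      (e := e) hc hδ0.le hD (fun i => (hz.continuousOn_chi i).mono fun u hu =>
        (le_max_right _ _).trans hu.1) (fun i => hB T (le_max_right _ _) i) (fun u hu i => ?_) t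
      ⟨ht, le_rfl⟩ i
    refine ⟨(hμ _ i).1, ?_, ?_⟩
    · exact (hT₁ u ((le_max_left _ _).trans hu.1.1.le) i).trans
        (mul_le_mul_of_nonneg_right (hμ _ i).1 hδ0.le)
    · exact ((hsolve u ⟨⟨(le_max_right _ _).trans_lt hu.1.1, hu.1.2⟩, hu.2⟩).hasDerivAt_chi
        i).congr_deriv (add_sub_assoc _ _ _)
  have hexp : Tendsto (fun t => (∑ k ∈ Finset.range n, (2 / c) ^ k) * B *
      Real.exp (-(c / 2) * (t - T))) atTop (𝓝 0) := by
    have h1 : Tendsto (fun t : ℝ => -(c / 2) * (t - T)) atTop atBot :=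
      (tendsto_atTop_add_const_right atTop (-T) tendsto_id).const_mul_atTop_of_neg (by linarith)
    simpa using (Real.tendsto_exp_atBot.comp h1).const_mul
      ((∑ k ∈ Finset.range n, (2 / c) ^ k) * B)
  obtain ⟨T₂, hT₂⟩ := eventually_atTop.1 (hexp.eventually_lt_const (half_pos hη))
  refine ⟨max T T₂, fun t ht => ?_⟩
  rw [Real.dist_eq, sub_zero]
  have h1 := hdecay t ((le_max_left _ _).trans ht)
  have h2 := hT₂ t ((le_max_right _ _).trans ht)
  have h3 : δ * cascadeGain c n ≤ η / 2 := by
    rw [hδ, div_mul_eq_mul_div, div_le_div_iff₀ (by positivity) two_pos]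
    nlinarith
  linarith

theorem IsTrajectory.tendsto_tracking_error (hn : 0 < n) :
    Tendsto (fun t => (z t).x ⟨0, hn⟩ - r 0 t) atTop (𝓝 0) := by
  have h := (hz.tendsto_eps hφ hsf hr hd ⟨0, hn⟩).sub (hz.tendsto_chi hφ hsf hr hd ⟨0, hn⟩)
  rw [sub_zero] at h
  refine h.congr fun t => ?_
  rw [eps_eq_hAt_add_chi, Pi.add_apply, add_sub_cancel_right]
  simp [hAt, hErr, pt, alpha]

end Tracking

end

/-! ### Global existence of solutions -/

section

/-! ### Global existence from an a priori bound -/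

section GlobalExistence

variable {E F : Type*} [NormedAddCommGroup E] [NormedSpace ℝ E] [FiniteDimensional ℝ E]
  [NormedAddCommGroup F] [NormedSpace ℝ F] [FiniteDimensional ℝ F]

omit [FiniteDimensional ℝ E] in
/-- A bounded, uniformly Lipschitz, continuous time-dependent vector field has a global forward
solution. -/
theorem exists_forward_solution [CompleteSpace E] {g : ℝ → E → E} {K L : NNReal} {t₀ : ℝ} (v₀ : E)
    (hLip : ∀ t, LipschitzWith K (g t)) (hcont : ∀ v, ContinuousOn (fun t => g t v) (Set.Ici t₀))
    (hL : ∀ t v, ‖g t v‖ ≤ L) :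
    ∃ v : ℝ → E, v t₀ = v₀ ∧
      ∀ t ∈ Set.Ici t₀, HasDerivWithinAt v (g t (v t)) (Set.Ici t₀) t := by
  have hloc : ∀ N : ℕ, ∃ α : ℝ → E, α t₀ = v₀ ∧ ∀ t ∈ Set.Icc t₀ (t₀ + N),
      HasDerivWithinAt α (g t (α t)) (Set.Icc t₀ (t₀ + N)) t := by
    intro N
    have hmem : t₀ ∈ Set.Icc t₀ (t₀ + N) := ⟨le_rfl, by simp⟩
    -- At speed at most L the ball of radius LN is not left within time N, so the interval need not
    -- be shortened.
    have hPL : IsPicardLindelof g (⟨t₀, hmem⟩ : Set.Icc t₀ (t₀ + N)) v₀ (L * N) 0 L K :=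
      { lipschitzOnWith := fun t _ => (hLip t).lipschitzOnWith
        continuousOn := fun v _ => (hcont v).mono fun t ht => ht.1
        norm_le := fun t _ v _ => hL t v
        mul_max_le := by simp }
    exact hPL.exists_eq_forall_mem_Icc_hasDerivWithinAt₀
  choose α hα0 hα using hloc
  have hright : ∀ (N : ℕ) (b : ℝ), b ≤ t₀ + N → ∀ t ∈ Set.Ico t₀ b,
      HasDerivWithinAt (α N) (g t (α N t)) (Set.Ici t) t := fun N b hb t ht =>
    (hα N t ⟨ht.1, ht.2.le.trans hb⟩).mono_of_mem_nhdsWithin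
      (mem_of_superset (Icc_mem_nhdsGE (ht.2.trans_le hb)) (Set.Icc_subset_Icc_left ht.1))
  have heq : ∀ M N : ℕ, ∀ t, t₀ ≤ t → t ≤ t₀ + M → t ≤ t₀ + N → α M t = α N t := by
    intro M N t ht hM hN
    refine ODE_solution_unique hLip (fun u hu => ?_) (hright M t hM) (fun u hu => ?_)
      (hright N t hN) ((hα0 M).trans (hα0 N).symm) ⟨ht, le_rfl⟩
    · exact (hα M u ⟨hu.1, hu.2.trans hM⟩).continuousWithinAt.mono (Set.Icc_subset_Icc_right hM)
    · exact (hα N u ⟨hu.1, hu.2.trans hN⟩).continuousWithinAt.mono (Set.Icc_subset_Icc_right hN)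
  have hceil : ∀ t, t ≤ t₀ + ⌈t - t₀⌉₊ := fun t => by linarith [Nat.le_ceil (t - t₀)]
  refine ⟨fun t => α ⌈t - t₀⌉₊ t, hα0 _, fun t ht => ?_⟩
  -- One more than needed, so that the glued solution agrees with a single local one on a
  -- neighbourhood of `t` in the half-line.
  set N := ⌈t - t₀⌉₊ + 1 with hN
  have htN : t < t₀ + N := by
    rw [hN]; push_cast; linarith [hceil t]
  have hd : HasDerivWithinAt (α N) (g t (α N t)) (Set.Ici t₀) t :=
    (hα N t ⟨ht, htN.le⟩).mono_of_mem_nhdsWithin (by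
      rw [← Set.Ici_inter_Iic]
      exact inter_mem_nhdsWithin _ (Iic_mem_nhds htN))
  beta_reduce
  rw [heq _ N t ht (hceil t) htN.le]
  refine hd.congr_of_eventuallyEq ?_ (heq _ N t ht (hceil t) htN.le)
  filter_upwards [self_mem_nhdsWithin, mem_nhdsWithin_of_mem_nhds (Iic_mem_nhds htN)] with u hu huN
  exact heq _ N u hu (hceil u) huN

/-- If solutions of `v' = G (v, ρ t)` satisfy an a priori bound, then there is a global forward
solution. -/
theorem exists_forward_solution_of_apriori_bound {G : E × F → E} (hG : ContDiff ℝ ∞ G)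
    {ρ : ℝ → F} {t₀ C B : ℝ} (hρ : ContinuousOn ρ (Set.Ici t₀)) (hC : ∀ t, t₀ ≤ t → ‖ρ t‖ ≤ C)
    (v₀ : E)
    (hB : ∀ τ (v : ℝ → E), v t₀ = v₀ →
      (∀ t ∈ Set.Ico t₀ τ, HasDerivWithinAt v (G (v t, ρ t)) (Set.Ico t₀ τ) t) →
      ∀ t ∈ Set.Ico t₀ τ, ‖v t‖ ≤ B) :
    ∃ v : ℝ → E, v t₀ = v₀ ∧
      ∀ t ∈ Set.Ici t₀, HasDerivWithinAt v (G (v t, ρ t)) (Set.Ici t₀) t := by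
  have := FiniteDimensional.complete ℝ E
  set B' := max ‖v₀‖ B + 1 with hB'
  have hB'0 : 0 < B' := by positivity
  -- The cutoff makes the field bounded and globally Lipschitz, and is 1 wherever ‖v‖ ≤ B' and ‖ρ‖ ≤
  -- C.
  let b : ContDiffBump (0 : E × F) := ⟨max B' C, max B' C + 1, lt_max_of_lt_left hB'0, by linarith⟩
  have hsm : ContDiff ℝ ∞ fun q => b q • G q := b.contDiff.smul hG
  have hsupp : HasCompactSupport fun q => b q • G q := b.hasCompactSupport.smul_right
  obtain ⟨K, hK⟩ := hsm.lipschitzWith_of_hasCompactSupport hsupp (by simp)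
  obtain ⟨L, hL⟩ := hsm.continuous.bounded_above_of_compact_support hsupp
  have hLip : ∀ t, LipschitzWith K fun v => b (v, ρ t) • G (v, ρ t) := fun t => by
    have h1 : LipschitzWith 1 fun v : E => (v, ρ t) := LipschitzWith.prodMk_right _
    simpa [Function.comp_def] using hK.comp h1
  obtain ⟨v, hv0, hv⟩ := exists_forward_solution (L := L.toNNReal) (t₀ := t₀) v₀ hLip
    (fun v => hsm.continuous.comp_continuousOn (continuousOn_const.prodMk hρ))
    fun t v => (hL _).trans (Real.le_coe_toNNReal L)
  have hb1 : ∀ t, t₀ ≤ t → ‖v t‖ ≤ B' → b (v t, ρ t) • G (v t, ρ t) = G (v t, ρ t) := by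
    intro t ht hvt
    rw [b.one_of_mem_closedBall, one_smul]
    rw [mem_closedBall_zero_iff, norm_prod_le_iff]
    exact ⟨hvt.trans (le_max_left _ _), (hC t ht).trans (le_max_right _ _)⟩
  have hvc : ContinuousOn v (Set.Ici t₀) := fun t ht => (hv t ht).continuousWithinAt
  have hbound : ∀ t, t₀ ≤ t → ‖v t‖ < B' := by
    by_contra! hex
    obtain ⟨t₁, ht₁, hvt₁⟩ := hex
    have hScl : IsClosed (Set.Icc t₀ t₁ ∩ (fun t => ‖v t‖) ⁻¹' Set.Ici B') :=
      (hvc.norm.mono fun t ht => ht.1).preimage_isClosed_of_isClosed isClosed_Icc isClosed_Ici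
    -- First time at which the norm reaches B'. Before it the cutoff is inactive, so the a priori
    -- bound B holds, and by continuity also at τ; but B < B'.
    obtain ⟨τ, hτ, hmin⟩ := (isCompact_Icc.of_isClosed_subset hScl
      Set.inter_subset_left).exists_isLeast ⟨t₁, ⟨ht₁, le_rfl⟩, hvt₁⟩
    have hτ' : B' ≤ ‖v τ‖ := hτ.2
    have hlt : ∀ t ∈ Set.Ico t₀ τ, ‖v t‖ < B' := fun t ht => by
      by_contra! h
      exact absurd (hmin ⟨⟨ht.1, ht.2.le.trans hτ.1.2⟩, h⟩) (not_le.2 ht.2)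
    have hτ0 : t₀ < τ := by
      refine lt_of_le_of_ne hτ.1.1 fun h => ?_
      rw [← h, hv0] at hτ'
      linarith [le_max_left ‖v₀‖ B]
    have hle := hB τ v hv0 fun t ht => by
      have := (hv t ht.1).mono (Set.Ico_subset_Icc_self.trans fun u (hu : u ∈ Set.Icc t₀ τ) => hu.1)
      rwa [hb1 t ht.1 (hlt t ht).le] at this
    have hlim : Tendsto (fun t => ‖v t‖) (𝓝[Set.Ico t₀ τ] τ) (𝓝 ‖v τ‖) :=
      (hvc.norm τ hτ.1.1).mono_left (nhdsWithin_mono _ fun u hu => hu.1)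
    have : (𝓝[Set.Ico t₀ τ] τ).NeBot := by
      rw [← mem_closure_iff_nhdsWithin_neBot, closure_Ico hτ0.ne]
      exact ⟨hτ0.le, le_rfl⟩
    have := le_of_tendsto hlim (eventually_mem_nhdsWithin.mono fun t ht => hle t ht)
    linarith [le_max_right ‖v₀‖ B]
  refine ⟨v, hv0, fun t ht => ?_⟩
  have := hv t ht
  rwa [hb1 t ht (hbound t ht).le] at this

end GlobalExistence

/-! ### The closed loop as an autonomous system driven by the reference -/

variable {n p : ℕ}

/-- Closed-loop states in the coordinates `(x_i - r^{(i-1)}, θ̂, Ω, Ω₀)`. -/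
abbrev Phase (n p : ℕ) : Type := Vec n × Vec p × (Fin p → Fin n → ℝ) × Vec n

/-- The closed-loop state with coordinates `v` when the reference and its derivatives are `ρ`. -/
def stateOf (v : Phase n p) (ρ : Vec n) : State n p :=
  ⟨v.1 + ρ, v.2.1, Matrix.of v.2.2.1, v.2.2.2⟩

/-- The arguments of the virtual controls in shifted coordinates. -/
def ptOf (q : Phase n p × Vec n) : Pt n p := (q.1.1 + q.2, q.2, q.1.2.1)

/-- The update law in shifted coordinates. -/
def updateOf (d : Design n p) (φ : Fin n → Vec n → Vec p) (q : Phase n p × Vec n) : Vec p :=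
  (1 + d.ν * frobSq (Matrix.of q.1.2.2.1))⁻¹ • (d.Γ *ᵥ (Matrix.of q.1.2.2.1 *ᵥ
    (hErr d φ (ptOf q) + q.1.2.2.2 - (Matrix.of q.1.2.2.1)ᵀ *ᵥ q.1.2.1)))

/-- The closed-loop vector field in shifted coordinates. The derivative `r^{(n)}` cancels. -/
def closedLoopField (d : Design n p) (φ : Fin n → Vec n → Vec p) (θ : Vec p)
    (q : Phase n p × Vec n) : Phase n p :=
  (fun i => succCoord q.1.1 (alpha d φ n (ptOf q)) i + φ i (q.1.1 + q.2) ⬝ᵥ θ,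
   updateOf d φ q,
   fun j i => -s d φ (ptOf q) i * q.1.2.2.1 j i + entry (q.1.2.2.1 j) (i.val + 1)
     + w d φ (ptOf q) i j,
   fun i => -s d φ (ptOf q) i * q.1.2.2.2 i + entry q.1.2.2.2 (i.val + 1)
     + w d φ (ptOf q) i ⬝ᵥ q.1.2.1 + dTheta (alpha d φ i.val) (ptOf q) ⬝ᵥ updateOf d φ q)

theorem contDiff_mulVec {E : Type*} [NormedAddCommGroup E] [NormedSpace ℝ E] {m k : ℕ}
    {M : E → Matrix (Fin m) (Fin k) ℝ} {f : E → Vec k}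
    (hM : ∀ i j, ContDiff ℝ ∞ fun q => M q i j) (hf : ContDiff ℝ ∞ f) :
    ContDiff ℝ ∞ fun q => M q *ᵥ f q :=
  contDiff_pi.2 fun i => contDiff_dotProduct (contDiff_pi.2 (hM i)) hf

section Smooth

variable {d : Design n p} {φ : Fin n → Vec n → Vec p} (hφ : ∀ i, ContDiff ℝ ∞ (φ i))

theorem contDiff_ptOf : ContDiff ℝ ∞ (ptOf : Phase n p × Vec n → Pt n p) := by
  unfold ptOf
  fun_prop

include hφ

theorem contDiff_updateOf (hd : d.Admissible) : ContDiff ℝ ∞ (updateOf d φ) := by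
  have hΩ : ∀ j i, ContDiff ℝ ∞ fun q : Phase n p × Vec n => q.1.2.2.1 j i := fun j i => by
    fun_prop
  have hν : ContDiff ℝ ∞ fun q : Phase n p × Vec n => 1 + d.ν * frobSq (Matrix.of q.1.2.2.1) :=
    contDiff_const.add (contDiff_const.mul (ContDiff.sum fun j _ => ContDiff.sum fun i _ =>
      (hΩ j i).pow 2))
  refine (hν.inv fun q => ?_).smul ?_
  · exact (zero_lt_one.trans_le (one_le_normalization hd _)).ne'
  · refine contDiff_mulVec (fun _ _ => contDiff_const) (contDiff_mulVec hΩ ?_)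
    exact (((contDiff_hErr d hφ).comp contDiff_ptOf).add (by fun_prop)).sub
      (contDiff_mulVec (fun i j => hΩ j i) (by fun_prop))

theorem contDiff_closedLoopField (hd : d.Admissible) (θ : Vec p) :
    ContDiff ℝ ∞ (closedLoopField d φ θ) := by
  have hs : ∀ i, ContDiff ℝ ∞ fun q : Phase n p × Vec n => s d φ (ptOf q) i := fun i =>
    (contDiff_s d hφ i).comp contDiff_ptOf
  have hw : ∀ i, ContDiff ℝ ∞ fun q : Phase n p × Vec n => w d φ (ptOf q) i := fun i =>
    (contDiff_w d hφ i).comp contDiff_ptOf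
  have hΩ : ∀ j, ContDiff ℝ ∞ fun q : Phase n p × Vec n => q.1.2.2.1 j := fun j => by fun_prop
  have hΩ₀ : ContDiff ℝ ∞ fun q : Phase n p × Vec n => q.1.2.2.2 := by fun_prop
  refine ContDiff.prodMk (contDiff_pi.2 fun i => ?_) (ContDiff.prodMk (contDiff_updateOf hφ hd)
    (ContDiff.prodMk (contDiff_pi.2 fun j => contDiff_pi.2 fun i => ?_) (contDiff_pi.2 fun i => ?_)))
  · refine ContDiff.add ?_ (contDiff_dotProduct ((hφ i).comp (by fun_prop)) contDiff_const)
    unfold succCoord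
    split_ifs
    · fun_prop
    · exact (contDiff_alpha d hφ n).comp contDiff_ptOf
  · exact (((hs i).neg.mul (contDiff_pi.1 (hΩ j) i)).add (contDiff_entry (hΩ j) _)).add
      (contDiff_pi.1 (hw i) j)
  · exact ((((hs i).neg.mul (contDiff_pi.1 hΩ₀ i)).add (contDiff_entry hΩ₀ _)).add
      (contDiff_dotProduct (hw i) (by fun_prop))).add
      (contDiff_dotProduct ((contDiff_dTheta (contDiff_alpha d hφ i.val)).comp contDiff_ptOf)
        (contDiff_updateOf hφ hd))

end Smooth

section Existence

variable {d : Design n p} {φ : Fin n → Vec n → Vec p} {θ : Vec p} {r : ℕ → ℝ → ℝ}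

theorem hasPiecewiseDerivOn_of_forall {f f' : ℝ → ℝ} {J : Set ℝ}
    (h : ∀ t ∈ J, HasDerivWithinAt f (f' t) J t) : HasPiecewiseDerivOn f f' J :=
  ⟨fun t ht => (h t ht).continuousWithinAt, ∅, fun b _ => by simp, fun t ht => h t ht.1⟩

/-- In shifted coordinates the field depends on time only through the continuous signals r, …,
r^{(n-1)}. Adding the reference back restores r^{(n)} and its break points, which affect the plant
equations only. -/
theorem isSolution_stateOf (hr : IsReference n r) {J : Set ℝ} (hJ : J ⊆ Set.Ici 0)
    {v : ℝ → Phase n p}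
    (hv : ∀ t ∈ J, HasDerivWithinAt v
      (closedLoopField d φ θ (v t, fun i => r i.val t)) J t) :
    IsSolution d φ θ r J fun t => stateOf (v t) fun i => r i.val t := by
  have h1 := fun t ht => hasDerivWithinAt_pi.1 (hv t ht).fst
  have h2 := fun t ht => hasDerivWithinAt_pi.1 (hv t ht).snd.fst
  have h3 := fun t ht j => hasDerivWithinAt_pi.1
    (hasDerivWithinAt_pi.1 (hv t ht).snd.snd.fst j)
  have h4 := fun t ht => hasDerivWithinAt_pi.1 (hv t ht).snd.snd.snd
  refine ⟨fun i => ?_, fun i j => ?_, fun i => ?_, fun j => ?_⟩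
  · obtain ⟨hc, D, hD, hder⟩ := hr.hasPiecewiseDerivOn i.val i.isLt
    refine ⟨ContinuousOn.add (fun t ht => (h1 t ht i).continuousWithinAt) (hc.mono hJ), D, ?_, ?_⟩
    · intro b hb
      exact (hD b (hJ hb)).subset (Set.inter_subset_inter_left _ (Set.inter_subset_inter_right _ hJ))
    · rintro t ⟨ht, htD⟩
      refine ((h1 t ht i).add ((hder t ⟨hJ ht, htD⟩).mono hJ)).congr_deriv ?_
      have : succCoord (stateOf (v t) fun i => r i.val t).x
          (control d φ r t (stateOf (v t) fun i => r i.val t)) i =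
          succCoord (v t).1 (alpha d φ n (ptOf (v t, fun i => r i.val t))) i + r (i.val + 1) t := by
        unfold succCoord
        split_ifs with hi
        · rfl
        · have : i.val + 1 = n := by have := i.isLt; omega
          rw [this]
          rfl
      beta_reduce
      rw [this]
      simp only [closedLoopField, stateOf]
      ring
  · refine hasPiecewiseDerivOn_of_forall fun t ht => (h3 t ht j i).congr_deriv ?_
    rw [Matrix.add_apply]
    exact congrArg (· + _) (A_mulVec d φ _ ((v t).2.2.1 j) i).symm
  · refine hasPiecewiseDerivOn_of_forall fun t ht => (h4 t ht i).congr_deriv ?_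
    rw [Pi.sub_apply, Pi.add_apply, A_mulVec, W_transpose_mulVec, Q_transpose_mulVec,
      sub_neg_eq_add]
    rfl
  · exact hasPiecewiseDerivOn_of_forall fun t ht => h2 t ht j

/-- The a priori bound is `exists_signals_bound` on finite horizons [t₀, τ); undoing the shift of x
costs the bound on the reference. -/
theorem exists_global_solution (hφ : ∀ i, ContDiff ℝ ∞ (φ i)) (hsf : IsStrictFeedback φ)
    (hr : IsReference n r) (hd : d.Admissible) {t₀ : ℝ} (ht₀ : 0 ≤ t₀) (z₀ : State n p) :
    ∃ z : ℝ → State n p, z t₀ = z₀ ∧ IsSolution d φ θ r (Set.Ici t₀) z := by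
  set ρ : ℝ → Vec n := fun t i => r i.val t with hρ
  obtain ⟨R, hR⟩ := z₀.exists_boundedBy
  obtain ⟨B, hB⟩ := exists_signals_bound hφ hsf hr hd θ R
  have hJ : Set.Ici t₀ ⊆ Set.Ici 0 := Set.Ici_subset_Ici.2 ht₀
  have hρc : ContinuousOn ρ (Set.Ici t₀) :=
    continuousOn_pi.2 fun i => (hr.hasPiecewiseDerivOn i.val i.isLt).1.mono hJ
  obtain ⟨C, hC⟩ : ∃ C, ∀ t, t₀ ≤ t → ‖ρ t‖ ≤ C := by
    choose c hc using fun i : Fin n => hr.bounded i.val i.isLt.le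
    obtain ⟨C, hC⟩ := Finite.exists_le c
    exact ⟨|C|, fun t ht => (pi_norm_le_iff_of_nonneg (abs_nonneg C)).2 fun i =>
      (hc i t (ht₀.trans ht)).trans ((hC i).trans (le_abs_self C))⟩
  have hz₀ : stateOf (z₀.x - ρ t₀, z₀.θhat, Matrix.of.symm z₀.Ω, z₀.Ω₀) (ρ t₀) = z₀ := by
    simp [stateOf]
  obtain ⟨v, hv0, hv⟩ := exists_forward_solution_of_apriori_bound (B := B + C)
    (contDiff_closedLoopField hφ hd θ) hρc hC
    (z₀.x - ρ t₀, z₀.θhat, Matrix.of.symm z₀.Ω, z₀.Ω₀) (by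
      intro τ v hv0 hv t ht
      have hsol := isSolution_stateOf hr (fun u hu => hJ hu.1) hv
      have htraj : IsTrajectory d φ θ r R t₀ (Set.Ico t₀ τ) fun t => stateOf (v t) (ρ t) :=
        ⟨ht₀, Or.inr ⟨τ, rfl⟩, hsol, by rw [hv0, hz₀]; exact hR⟩
      obtain ⟨⟨b1, b2, b3, b4⟩, -⟩ := hB t _ (htraj.reachable ht)
      have hC' := hC t ht.1
      have hC0 : 0 ≤ C := (norm_nonneg _).trans hC'
      have hB0 : 0 ≤ B := (vnorm_nonneg _).trans b1
      have hBC : 0 ≤ B + C := add_nonneg hB0 hC0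
      rw [norm_prod_le_iff, norm_prod_le_iff, norm_prod_le_iff]
      refine ⟨?_, ?_, ?_, ?_⟩
      · have h1 : (v t).1 = (stateOf (v t) (ρ t)).x - ρ t := (add_sub_cancel_right _ _).symm
        rw [h1]
        exact (norm_sub_le _ _).trans (add_le_add ((norm_le_vnorm _).trans b1) hC')
      · exact (norm_le_vnorm _).trans (b2.trans (le_add_of_nonneg_right hC0))
      · refine (pi_norm_le_iff_of_nonneg hBC).2 fun j => (pi_norm_le_iff_of_nonneg hBC).2 fun i => ?_
        exact (abs_entry_le_sqrt_frobSq (stateOf (v t) (ρ t)).Ω j i).trans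
          (b3.trans (le_add_of_nonneg_right hC0))
      · exact (norm_le_vnorm _).trans (b4.trans (le_add_of_nonneg_right hC0)))
  exact ⟨fun t => stateOf (v t) (ρ t), by simp only [hv0, hz₀], isSolution_stateOf hr hJ hv⟩

end Existence

end

/-! ### Explicit bounds on the safety violation -/

section

variable {n p : ℕ}

/-! ### The amplification factor and the initial errors -/

theorem geomFactor_eq_cascadeGain (hn : 0 < n) {c : ℝ} (hc : 0 < c) :
    geomFactor n c = cascadeGain c n := by
  rw [geomFactor]
  split_ifs with h1
  · simp [h1, cascadeGain]
  -- The geometric sum with denominators cleared, so that the induction includes m = 0.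
  · have key : ∀ m, cascadeGain c m * (c ^ m * (c - 1)) = c * (c ^ m - 1) := by
      intro m
      induction m with
      | zero => simp [cascadeGain]
      | succ m ih =>
        have : (1 + c⁻¹ * cascadeGain c m) * (c ^ (m + 1) * (c - 1)) =
            c ^ (m + 1) * (c - 1) + cascadeGain c m * (c ^ m * (c - 1)) := by
          field_simp
          ring
        rw [cascadeGain_succ, this, ih]
        ring
    obtain ⟨m, rfl⟩ : ∃ m, n = m + 1 := ⟨n - 1, by omega⟩
    have hc1 : c - 1 ≠ 0 := sub_ne_zero.2 h1
    rw [Nat.add_sub_cancel, div_eq_iff (by positivity)]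
    have h2 := key (m + 1)
    refine mul_left_cancel₀ hc.ne' ?_
    rw [← h2]
    ring

/-- By the definition of α_i, h_{i+1} = N_i + s_i h_i. If h_i > 0, then s_i ≥ c_i ≥ -N_i/h_i makes
this nonnegative; if h_i = 0, it is the condition N_i ≥ 0. -/
theorem hErr_nonneg_of_gainChoice {d : Design n p} (hd : d.Admissible)
    {φ : Fin n → Vec n → Vec p} {q : Pt n p} (hn : 0 < n) (hg : GainChoice d φ q)
    (h0 : 0 ≤ hErr d φ q ⟨0, hn⟩) (i : Fin n) : 0 ≤ hErr d φ q i := by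
  obtain ⟨k, hk⟩ := i
  induction k with
  | zero => exact h0
  | succ k ih =>
    have hkn : k < n := by omega
    have hpos := ih hkn
    obtain ⟨hne, hzero⟩ := hg ⟨k, hkn⟩ hk
    have hstep : hErr d φ q ⟨k + 1, hk⟩ = gainNumerator d φ q ⟨k, hkn⟩
        + s d φ q ⟨k, hkn⟩ * hErr d φ q ⟨k, hkn⟩ := by
      have hα := alpha_succ d φ q ⟨k, hkn⟩
      have h1 : hErr d φ q ⟨k + 1, hk⟩ = q.1 ⟨k + 1, hk⟩ - alpha d φ (k + 1) q - q.2.1 ⟨k + 1, hk⟩ :=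
        rfl
      rw [h1, gainNumerator]
      simp only [succCoord, dif_pos hk]
      simp only at hα
      rw [hα]
      ring
    rw [hstep]
    rcases hpos.eq_or_lt with h | h
    · rw [← h, mul_zero, add_zero]
      exact hzero h.symm
    · have hc := (le_max_left _ _).trans (hne h.ne')
      have hs := hc.trans (c_le_s hd φ q ⟨k, hkn⟩)
      have h2 := mul_le_mul_of_nonneg_right hs h.le
      have h3 : gainLower d φ q ⟨k, hkn⟩ * hErr d φ q ⟨k, hkn⟩ = -gainNumerator d φ q ⟨k, hkn⟩ := by
        rw [gainLower]
        field_simp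
      linarith

/-! ### Norm bounds for the update law -/

theorem vnorm_smul {m : ℕ} (a : ℝ) (v : Vec m) : vnorm (a • v) = |a| * vnorm v := by
  rw [vnorm, WithLp.toLp_smul, norm_smul, Real.norm_eq_abs, vnorm]

theorem frobSq_eq_sum_vnorm_sq {m k : ℕ} (M : Matrix (Fin m) (Fin k) ℝ) :
    frobSq M = ∑ j, vnorm (M j) ^ 2 :=
  Finset.sum_congr rfl fun j _ => (vnorm_sq (M j)).symm

theorem frobSq_transpose {m k : ℕ} (M : Matrix (Fin m) (Fin k) ℝ) : frobSq Mᵀ = frobSq M :=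
  Finset.sum_comm

theorem vnorm_mulVec_le {m k : ℕ} (M : Matrix (Fin m) (Fin k) ℝ) (v : Vec k) :
    vnorm (M *ᵥ v) ≤ √(frobSq M) * vnorm v := by
  refine abs_le_of_sq_le_sq' ?_ (mul_nonneg (Real.sqrt_nonneg _) (vnorm_nonneg v)) |>.2
  rw [mul_pow, Real.sq_sqrt (frobSq_nonneg M), vnorm_sq, frobSq_eq_sum_vnorm_sq, Finset.sum_mul]
  refine Finset.sum_le_sum fun i _ => ?_
  rw [← mul_pow]
  exact sq_le_sq.2 ((dotProduct_le_vnorm (M i) v).trans (le_abs_self _))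

theorem dTheta_alpha_zero (d : Design n p) (φ : Fin n → Vec n → Vec p) (q : Pt n p) :
    dTheta (alpha d φ 0) q = 0 := by
  ext j
  simp [dTheta, alpha]

theorem Design.Admissible.cMin_pos {d : Design n p} (hd : d.Admissible) (hn : 0 < n) :
    0 < d.cMin := by
  have : Nonempty (Fin n) := ⟨⟨0, hn⟩⟩
  obtain ⟨i, hi⟩ := exists_eq_ciInf_of_finite (f := d.c)
  exact (hd.c_pos i).trans_eq hi

theorem Design.Admissible.κMin_pos {d : Design n p} (hd : d.Admissible) (hn : 0 < n) :
    0 < d.κMin := by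
  have : Nonempty (Fin n) := ⟨⟨0, hn⟩⟩
  obtain ⟨i, hi⟩ := exists_eq_ciInf_of_finite (f := d.κ)
  exact (hd.κ_pos i).trans_eq hi

theorem Design.Admissible.gMin_pos {d : Design n p} (hd : d.Admissible) {i : Fin n}
    (hi : 0 < i.val) : 0 < d.gMin := by
  have : Nonempty {i : Fin n // 0 < i.val} := ⟨⟨i, hi⟩⟩
  obtain ⟨k, hk⟩ := exists_eq_ciInf_of_finite (f := fun i : {i : Fin n // 0 < i.val} => d.g i.val)
  exact (hd.g_pos k.val).trans_eq hk

/-! ### Bounds on the safety violation -/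

section Violation

variable {d : Design n p} {φ : Fin n → Vec n → Vec p} {θ : Vec p} {r : ℕ → ℝ → ℝ} {R t₀ : ℝ}
  {J : Set ℝ} {z : ℝ → State n p}

theorem IsTrajectory.epsTilde_eq_zero (hφ : ∀ i, ContDiff ℝ ∞ (φ i)) (hsf : IsStrictFeedback φ)
    (hr : IsReference n r) (hd : d.Admissible) (hz : IsTrajectory d φ θ r R t₀ J z)
    (h0 : epsTilde d φ θ r t₀ (z t₀) = 0) {t : ℝ} (ht : t ∈ J) :
    epsTilde d φ θ r t (z t) = 0 := by
  obtain ⟨c, hc, μ, -, hμ⟩ := exists_gain_bounds hd φ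
  obtain ⟨D, hD, hsolve⟩ := hz.exists_solvesAt hr ht
  ext i
  have := cascade_abs_le (R := 0) (M := 0) (S := fun t => s d φ (pt r t (z t)))
    (ξ := fun t => epsTilde d φ θ r t (z t)) (e := fun _ _ => 0) hc le_rfl hD
    (fun i => (hz.continuousOn_epsTilde hφ hr i).mono (hz.horizon.Icc_subset ht))
    (fun i => by simp [h0]) (fun u hu i => ⟨(hμ _ i).1, by simp, by
      simpa using (hsolve u hu).hasDerivAt_epsTilde hφ hsf i⟩) t ⟨hz.start_le ht, le_rfl⟩ i
  simpa using this

theorem IsTrajectory.vnorm_thetaTilde_le (hr : IsReference n r) (hd : d.Admissible) {γ : ℝ}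
    (hγ : 0 < γ) (hΓ : d.Γ = γ • (1 : Matrix (Fin p) (Fin p) ℝ))
    (hz : IsTrajectory d φ θ r R t₀ J z) (hε : ∀ t ∈ J, epsTilde d φ θ r t (z t) = 0) {t : ℝ}
    (ht : t ∈ J) : vnorm (θ - (z t).θhat) ≤ vnorm (θ - (z t₀).θhat) := by
  have hV : ∀ v : Vec p, v ⬝ᵥ d.Γ⁻¹ *ᵥ v = γ⁻¹ * vnorm v ^ 2 := by
    intro v
    have h1 : d.Γ *ᵥ (γ⁻¹ • v) = v := by
      rw [hΓ, Matrix.smul_mulVec, Matrix.one_mulVec, smul_smul, mul_inv_cancel₀ hγ.ne', one_smul]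
    have h2 : d.Γ⁻¹ *ᵥ v = γ⁻¹ • v := by
      conv_lhs => rw [← h1]
      rw [Matrix.mulVec_mulVec, inv_mul_of_posDef hd.Γ_pos, Matrix.one_mulVec]
    rw [h2, dotProduct_smul, smul_eq_mul, vnorm_sq]
    simp only [dotProduct, sq]
  obtain ⟨D, hD, hsolve⟩ := hz.exists_solvesAt hr ht
  have hsub := hz.horizon.Icc_subset ht
  have hmono := le_of_deriv_nonpos_off_finite hD (hz.start_le ht)
    (f := fun t => (θ - (z t).θhat) ⬝ᵥ (d.Γ⁻¹ *ᵥ (θ - (z t).θhat)))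
    (hz.continuousOn_lyapunov.mono hsub) (by
      intro u hu
      -- As ε̃ = 0, K = 0 removes the exponential correction, and the rate 1 is arbitrary.
      obtain ⟨V', hV', hder⟩ := (hsolve u hu).exists_dissipation (K := 0) (t₀ := t₀) hd one_pos
        (fun i => by simp [hε u (hsub ⟨hu.1.1.le, hu.1.2.le⟩)])
      refine ⟨V', hV'.trans (neg_nonpos.2 (mul_nonneg (inv_nonneg.2 (zero_le_one.trans
        (one_le_normalization hd _))) (Finset.sum_nonneg fun _ _ => sq_nonneg _))), ?_⟩
      simpa using hder)
  simp only [hV] at hmono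
  exact abs_le_of_sq_le_sq' (le_of_mul_le_mul_left hmono (inv_pos.2 hγ)) (vnorm_nonneg _) |>.2

/-- Here ε = Ωᵀθ̃, so |Ωε| ≤ |Ω|_F²|θ̃|, and normalization leaves ν|Ω|_F²/(1 + ν|Ω|_F²) ≤ 1. This
needs no bound on Ω. -/
theorem vnorm_updateLaw_le {γ e : ℝ} (hγ : 0 < γ)
    (hΓ : d.Γ = γ • (1 : Matrix (Fin p) (Fin p) ℝ)) (hν : 0 < d.ν) {t : ℝ} {y : State n p}
    (hε : epsTilde d φ θ r t y = 0) (he : vnorm (θ - y.θhat) ≤ e) :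
    vnorm (updateLaw d φ r t y) ≤ γ / d.ν * e := by
  have hF := frobSq_nonneg y.Ω
  have hm : 0 < 1 + d.ν * frobSq y.Ω := by positivity
  have h1 : vnorm (y.Ω *ᵥ (y.Ωᵀ *ᵥ (θ - y.θhat))) ≤ frobSq y.Ω * e := by
    calc _ ≤ √(frobSq y.Ω) * (√(frobSq y.Ω) * vnorm (θ - y.θhat)) := by
          refine (vnorm_mulVec_le _ _).trans ?_
          have := vnorm_mulVec_le y.Ωᵀ (θ - y.θhat)
          rw [frobSq_transpose] at this
          gcongr
      _ = frobSq y.Ω * vnorm (θ - y.θhat) := by rw [← mul_assoc, Real.mul_self_sqrt hF]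
      _ ≤ _ := by gcongr
  rw [updateLaw, hΓ, eps_eq_epsTilde_add d φ θ, hε, zero_add, Matrix.smul_mulVec, Matrix.one_mulVec,
    vnorm_smul, vnorm_smul, abs_of_pos (inv_pos.2 hm), abs_of_pos hγ]
  have he0 : 0 ≤ e := (vnorm_nonneg _).trans he
  calc _ ≤ (1 + d.ν * frobSq y.Ω)⁻¹ * (γ * (frobSq y.Ω * e)) := by gcongr
    _ = (d.ν * frobSq y.Ω) / (1 + d.ν * frobSq y.Ω) * (γ / d.ν * e) := by field_simp
    _ ≤ 1 * (γ / d.ν * e) := by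
        gcongr
        rw [div_le_one hm]
        linarith
    _ = _ := one_mul _

theorem abs_disturbance_le (hd : d.Admissible) (hn : 0 < n) {γ e : ℝ} (hγ : 0 < γ) (hν : 0 < d.ν)
    (q : Pt n p) {v u : Vec p} (hv : vnorm v ≤ e) (hu : vnorm u ≤ γ / d.ν * e) (i : Fin n) :
    |w d φ q i ⬝ᵥ v - dTheta (alpha d φ i.val) q ⬝ᵥ u| ≤
      s d φ q i * ((1 / √(d.cMin * d.κMin)
        + (if n = 1 then 0 else γ / (d.ν * √(d.cMin * d.gMin)))) / 2 * e) := by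
  have he : 0 ≤ e := (vnorm_nonneg _).trans hv
  have hc := hd.cMin_pos hn
  have hci : d.cMin ≤ d.c i := ciInf_le (Set.finite_range d.c).bddBelow i
  have hs : 0 ≤ s d φ q i := hc.le.trans (hci.trans (c_le_s hd φ q i))
  have h1 : |w d φ q i ⬝ᵥ v| ≤ s d φ q i * (1 / √(d.cMin * d.κMin) / 2) * e :=
    (dotProduct_le_vnorm _ _).trans (mul_le_mul (vnorm_w_le hd φ q i hc (hd.κMin_pos hn) hci
      (ciInf_le (Set.finite_range d.κ).bddBelow i)) hv (vnorm_nonneg _)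
      (mul_nonneg hs (by positivity)))
  have h2 : |dTheta (alpha d φ i.val) q ⬝ᵥ u| ≤
      s d φ q i * ((if n = 1 then 0 else γ / (d.ν * √(d.cMin * d.gMin))) / 2 * e) := by
    -- Since α_0 = 0, the first equation has no such term; hence g_1 is left out of the minimum.
    rcases Nat.eq_zero_or_pos i.val with hi | hi
    · rw [hi, dTheta_alpha_zero, zero_dotProduct, abs_zero]
      refine mul_nonneg hs (mul_nonneg (div_nonneg ?_ two_pos.le) he)
      split_ifs
      exacts [le_rfl, by positivity]
    · have hn1 : n ≠ 1 := by have := i.isLt; omega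
      have hgi : d.gMin ≤ d.g i :=
        ciInf_le (f := fun i : {i : Fin n // 0 < i.val} => d.g i.val)
          (Set.finite_range _).bddBelow ⟨i, hi⟩
      rw [if_neg hn1]
      have hg := hd.gMin_pos hi
      calc _ ≤ _ := dotProduct_le_vnorm _ _
        _ ≤ s d φ q i * (1 / √(d.cMin * d.gMin) / 2) * (γ / d.ν * e) :=
          mul_le_mul (vnorm_dTheta_le hd φ q i hc hg hci hgi) hu (vnorm_nonneg _)
            (mul_nonneg hs (by positivity))
        _ = _ := by field_simp
  calc _ ≤ _ := abs_sub _ _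
    _ ≤ _ := add_le_add h1 h2
    _ = _ := by ring

theorem IsTrajectory.violation_bounds (hn : 0 < n) (hφ : ∀ i, ContDiff ℝ ∞ (φ i))
    (hsf : IsStrictFeedback φ) (hr : IsReference n r) (hd : d.Admissible) {γ : ℝ} (hγ : 0 < γ)
    (hΓ : d.Γ = γ • (1 : Matrix (Fin p) (Fin p) ℝ)) (hν : 0 < d.ν)
    (hz : IsTrajectory d φ θ r R t₀ J z) (hε : epsTilde d φ θ r t₀ (z t₀) = 0)
    (h0 : ∀ i, 0 ≤ hAt d φ r t₀ (z t₀) i) {t : ℝ} (ht : t ∈ J) :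
    -hStar d γ (vnorm (θ - (z t₀).θhat)) ≤ hAt d φ r t (z t) ⟨0, hn⟩ ∧
      hAt d φ r t (z t) ⟨0, hn⟩ ≤
        freeResponse d.cMin (entry (hAt d φ r t₀ (z t₀))) n 0 (t - t₀)
          + hStar d γ (vnorm (θ - (z t₀).θhat)) := by
  have hc := hd.cMin_pos hn
  set e := vnorm (θ - (z t₀).θhat) with he
  set M := (1 / √(d.cMin * d.κMin)
        + (if n = 1 then 0 else γ / (d.ν * √(d.cMin * d.gMin)))) / 2 * e with hM
  have hM0 : 0 ≤ M := by
    refine mul_nonneg (div_nonneg (add_nonneg (by positivity) ?_) two_pos.le) (vnorm_nonneg _)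
    split_ifs
    exacts [le_rfl, by positivity]
  have hstar : hStar d γ e = M * cascadeGain d.cMin n := by
    rw [hStar, geomFactor_eq_cascadeGain hn hc, hM]
    ring
  have hε' : ∀ t ∈ J, epsTilde d φ θ r t (z t) = 0 := fun t ht =>
    hz.epsTilde_eq_zero hφ hsf hr hd hε ht
  obtain ⟨D, hD, hsolve⟩ := hz.exists_solvesAt hr ht
  have hsub := hz.horizon.Icc_subset ht
  set η : ℝ → Vec n := fun t i => w d φ (pt r t (z t)) i ⬝ᵥ (θ - (z t).θhat)
    - dTheta (alpha d φ i.val) (pt r t (z t)) ⬝ᵥ updateLaw d φ r t (z t)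
  have hη : ∀ u ∈ Set.Ioo t₀ t \ D, ∀ i, |η u i| ≤ s d φ (pt r u (z u)) i * M := fun u hu i => by
    have huJ : u ∈ J := hsub ⟨hu.1.1.le, hu.1.2.le⟩
    have hθ := hz.vnorm_thetaTilde_le hr hd hγ hΓ hε' huJ
    exact abs_disturbance_le hd hn hγ hν _ hθ (vnorm_updateLaw_le hγ hΓ hν (hε' u huJ) hθ) i
  have hder : ∀ u ∈ Set.Ioo t₀ t \ D, ∀ i, HasDerivAt (fun t => hAt d φ r t (z t) i)
      (-s d φ (pt r u (z u)) i * hAt d φ r u (z u) i + entry (hAt d φ r u (z u)) (i.val + 1)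
        + η u i) u := fun u hu i =>
    ((hsolve u hu).hasDerivAt_hAt hφ hsf i).congr_deriv (add_sub_assoc _ _ _)
  have hcs : ∀ q i, d.cMin ≤ s d φ q i := fun q i =>
    (ciInf_le (Set.finite_range d.c).bddBelow i).trans (c_le_s hd φ q i)
  have hcont : ∀ i, ContinuousOn (fun t => hAt d φ r t (z t) i) (Set.Icc t₀ t) := fun i =>
    (hz.continuousOn_hAt hφ hr i).mono hsub
  have htt : t ∈ Set.Icc t₀ t := ⟨hz.start_le ht, le_rfl⟩
  rw [hstar]
  constructor
  -- For -h the initial values are nonpositive, so the zero majorant works and the lower bound has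
  -- no transient.
  · have := cascade_apply_le (ξ := fun t => -hAt d φ r t (z t))
      (S := fun t => s d φ (pt r t (z t))) (e := fun t => -η t) (a := 0) hc hM0 hD
      (fun i => (hcont i).neg) (fun _ => le_rfl) (fun i => neg_nonpos.2 (h0 i))
      (fun u hu i => ⟨hcs _ _, neg_le.1 (abs_le.1 (hη u hu i)).1,
        (hder u hu i).neg.congr_deriv (by rw [entry_neg]; simp only [Pi.neg_apply]; ring)⟩)
      t htt ⟨0, hn⟩
    have hfree : freeResponse d.cMin (entry (0 : Vec n)) n 0 (t - t₀) = 0 := by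
      simp [freeResponse, entry]
    simp only [Pi.neg_apply, Nat.sub_zero, hfree] at this
    linarith
  · exact cascade_apply_le (ξ := fun t => hAt d φ r t (z t)) (S := fun t => s d φ (pt r t (z t)))
      (e := η) hc hM0 hD hcont h0 (fun _ => le_rfl)
      (fun u hu i => ⟨hcs _ _, (abs_le.1 (hη u hu i)).2, hder u hu i⟩) t htt ⟨0, hn⟩

end Violation

end

end HSwap

end

theorem theorem2 {n p : ℕ} (hn : 0 < n)
    (φ : Fin n → HSwap.Vec n → HSwap.Vec p) (hφ : ∀ i, ContDiff ℝ ∞ (φ i))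
    (hsf : HSwap.IsStrictFeedback φ) (θ : HSwap.Vec p)
    (r : ℕ → ℝ → ℝ) (hr : HSwap.IsReference n r)
    (d : HSwap.Design n p) (hd : d.Admissible) :
    -- (i) for every initial time and state there is a solution on the whole half-line,
    ((∀ t₀ : ℝ, 0 ≤ t₀ → ∀ z₀ : HSwap.State n p, ∃ z : ℝ → HSwap.State n p,
        z t₀ = z₀ ∧ HSwap.IsSolution d φ θ r (Set.Ici t₀) z) ∧
      -- all signals are globally uniformly bounded,
      (∀ R : ℝ, ∃ B : ℝ, ∀ t₀ : ℝ, 0 ≤ t₀ → ∀ J : Set ℝ, HSwap.IsHorizon t₀ J →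
        ∀ z : ℝ → HSwap.State n p, HSwap.IsSolution d φ θ r J z → (z t₀).BoundedBy R →
          ∀ t ∈ J, HSwap.SignalsBoundedBy d φ θ r t (z t) B) ∧
      -- and asymptotic tracking is achieved.
      (∀ t₀ : ℝ, 0 ≤ t₀ → ∀ z : ℝ → HSwap.State n p,
        HSwap.IsSolution d φ θ r (Set.Ici t₀) z →
          Tendsto (fun t => (z t).x ⟨0, hn⟩ - r 0 t) atTop (𝓝 0))) ∧
    -- (ii) the bounds on the safety violation
    (∀ γ : ℝ, 0 < γ → d.Γ = γ • (1 : Matrix (Fin p) (Fin p) ℝ) → 0 < d.ν →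
      ∀ J : Set ℝ, HSwap.IsHorizon 0 J →
      ∀ z : ℝ → HSwap.State n p, HSwap.IsSolution d φ θ r J z →
        HSwap.GainChoice d φ (HSwap.pt r 0 (z 0)) →
        0 ≤ (z 0).x ⟨0, hn⟩ - r 0 0 →
        (z 0).Ω = 0 → (z 0).Ω₀ = -HSwap.hAt d φ r 0 (z 0) →
        ∀ t ∈ J,
          -HSwap.hStar d γ (HSwap.vnorm (θ - (z 0).θhat)) ≤ (z t).x ⟨0, hn⟩ - r 0 t ∧
          (z t).x ⟨0, hn⟩ - r 0 t ≤
            Real.exp (-d.cMin * t) *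
              ∑ i : Fin n, t ^ i.val / (i.val.factorial : ℝ) * HSwap.hAt d φ r 0 (z 0) i
            + HSwap.hStar d γ (HSwap.vnorm (θ - (z 0).θhat))) := by
  refine ⟨⟨fun t₀ ht₀ z₀ => HSwap.exists_global_solution hφ hsf hr hd ht₀ z₀, fun R => ?_,
    fun t₀ ht₀ z hz => ?_⟩, ?_⟩
  · obtain ⟨B, hB⟩ := HSwap.exists_signals_bound hφ hsf hr hd θ R
    exact ⟨B, fun t₀ ht₀ J hJ z hz h0 t ht => hB t (z t) ⟨t₀, J, z, ⟨ht₀, hJ, hz, h0⟩, ht, rfl⟩⟩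
  · obtain ⟨R, hR⟩ := (z t₀).exists_boundedBy
    have htraj : HSwap.IsTrajectory d φ θ r R t₀ (Set.Ici t₀) z := ⟨ht₀, Or.inl rfl, hz, hR⟩
    exact htraj.tendsto_tracking_error hφ hsf hr hd hn
  · intro γ hγ hΓ hν J hJ z hz hgain h1 hΩ hΩ₀ t ht
    obtain ⟨R, hR⟩ := (z 0).exists_boundedBy
    have htraj : HSwap.IsTrajectory d φ θ r R 0 J z := ⟨le_rfl, hJ, hz, hR⟩
    have hfirst : ∀ t, HSwap.hAt d φ r t (z t) ⟨0, hn⟩ = (z t).x ⟨0, hn⟩ - r 0 t := fun t => by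
      simp [HSwap.hAt, HSwap.hErr, HSwap.pt, HSwap.alpha]
    -- The purpose of the filter initialization: the unknown θ drops out and h cancels.
    have hε : HSwap.epsTilde d φ θ r 0 (z 0) = 0 := by
      simp [HSwap.epsTilde, hΩ, hΩ₀]
    have h0 := HSwap.hErr_nonneg_of_gainChoice hd hn hgain
      (h1.trans_eq (hfirst 0).symm)
    have h := htraj.violation_bounds hn hφ hsf hr hd hγ hΓ hν hε h0 ht
    have hfree : HSwap.freeResponse d.cMin (HSwap.entry (HSwap.hAt d φ r 0 (z 0))) n 0 (t - 0) =
        Real.exp (-d.cMin * t) *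
          ∑ i : Fin n, t ^ i.val / (i.val.factorial : ℝ) * HSwap.hAt d φ r 0 (z 0) i := by
      rw [HSwap.freeResponse, sub_zero, Finset.sum_range]
      simp only [zero_add, HSwap.entry_val]
    rwa [hfirst, hfree] at h
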